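/- Let $G$ be a finite connected simple graph in which every vertex has degree at most $3$, and suppose that $G$ has no separating clique, i.e. there is no clique $K\subseteq V(G)$ such that the graph $G-K$ is disconnected (has two vertices not joined by a path). Let $S_{2,2,2}$ be the tree with seven vertices $a_0,a_1,a_2,b_1,b_2,c_1,c_2$ and edges $a_0a_1,\ a_0b_1,\ a_0c_1,\ a_1a_2,\ b_1b_2,\ c_1c_2$; its vertex $a_0$ of degree $3$ is called its center. If $G$ has an induced (i.e. chordless) cycle of length $p\ge 3$ and an induced subgraph isomorphic to $S_{2,2,2}$, then $G$ has an induced cycle of length at least $p/12$ that contains the center of some induced subgraph of $G$ isomorphic to $S_{2,2,2}$. -/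

import Mathlib

namespace SimpleGraph

/-- The tripod with three legs of length two: the vertex `0` is the center, the legs are
`0 - 1 - 4`, `0 - 2 - 5` and `0 - 3 - 6`. -/
def S222 : SimpleGraph (Fin 7) :=
  SimpleGraph.fromEdgeSet {s(0, 1), s(0, 2), s(0, 3), s(1, 4), s(2, 5), s(3, 6)}

/-- The vertex `v` is the center of some induced copy of `S222` in `G`. -/
def IsCenterOfInducedS222 {V : Type*} (G : SimpleGraph V) (v : V) : Prop :=
  ∃ H : S222 ↪g G, H 0 = v

/-- A separating clique: a clique whose removal leaves a disconnected graph, that is, a graph in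
which some two vertices are not joined by a path. -/
def IsSeparatingClique {V : Type*} (G : SimpleGraph V) (K : Set V) : Prop :=
  G.IsClique K ∧ ¬ (G.induce Kᶜ).Preconnected

end SimpleGraph

/-! The center `v` of an induced `S222` is a claw: its three neighbors are pairwise nonadjacent.
Since `{v}` does not separate, a shortest path off `v` from one neighbor to the other two closes up
with `v` to an induced cycle of length at least 4. This settles `p ≤ 48`.

For larger `p`, let S be the vertex set of the given cycle. Two devices are used. A vertex x of a
cycle of length at least 6 is a center if it carries a path x, u, u' with no further contact with
the cycle (`IsIndCycle.isCenter`). And if a path off S is attached to S at no more than six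
vertices, a longest arc between consecutive attachments has length at least p/6 and closes with a
suitable part of that path to a long induced cycle. Together they settle the cases where v lies on
S, is adjacent to S, or has only neighbors that are adjacent to S.

Otherwise let T be the set of vertices off S with a neighbor on S, and I the component of v off S ∪
T. If no long cycle through a center exists, every t in T with a neighbor in I is joined to the two
ends of an edge of S and to one vertex of I. These t form a set L of leaves of the graph H of edges
meeting I, and no clique of H separates v from L. By `exists_adm_center`, some induced path of H
between two leaves passes through v or carries a pendant path; a long arc of S closes it to the
required cycle (`IsIndCycle.exists_through_path`).

To find that path, take a path between leaves as near to v as possible. The last vertex w before it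
lies on no such path. If w has one neighbor x on the path, x carries a pendant path, or w is v
itself and the other neighbors of v give a rerouting. If the first and last neighbors of w are not
consecutive, rerouting through w is a contradiction. If they are consecutive, they form a clique,
which does not separate w from L, and a second route out of w gives a contradiction or a pendant
path (`Adm.of_triangle`). -/

namespace SimpleGraph

/-! ### Induced paths as vertex lists -/

section
variable {V : Type*} {G : SimpleGraph V}

/-- The list `l` runs along an induced path of `G`. -/
def IndPath (G : SimpleGraph V) : List V → Prop
  | [] => True
  | x :: l => IndPath G l ∧ x ∉ l ∧ ∀ y ∈ l, (G.Adj x y ↔ l.head? = some y)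

@[simp] theorem indPath_nil : IndPath G [] := trivial

theorem indPath_cons {x : V} {l : List V} :
    IndPath G (x :: l) ↔ IndPath G l ∧ x ∉ l ∧ ∀ y ∈ l, (G.Adj x y ↔ l.head? = some y) := Iff.rfl

@[simp] theorem indPath_singleton (x : V) : IndPath G [x] := by simp [indPath_cons]

/-- The relation between two vertex lists that makes their concatenation an induced path. -/
def Linked (G : SimpleGraph V) (A B : List V) : Prop :=
  ∀ a ∈ A, ∀ b ∈ B, a ≠ b ∧ (G.Adj a b ↔ A.getLast? = some a ∧ B.head? = some b)

theorem indPath_append {A B : List V} :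
    IndPath G (A ++ B) ↔ IndPath G A ∧ IndPath G B ∧ Linked G A B := by
  induction A with
  | nil => simp [Linked]
  | cons x A ih =>
    rw [List.cons_append, indPath_cons, ih, indPath_cons]
    rcases A with _ | ⟨y, A⟩
    · simp only [Linked, List.nil_append, List.mem_singleton, forall_eq]
      simp
      grind
    · have e1 : ∀ a, (x :: y :: A).getLast? = some a ↔ (y :: A).getLast? = some a := by
        intro a; simp
      have e2 : (y :: A).getLast? = some x → x ∈ y :: A := fun h => List.mem_of_getLast? h
      have e3 : ((y :: A) ++ B).head? = some y := by simp
      have e4 : (y :: A).head? = some y := by simp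
      rw [e3, e4]
      simp only [Linked, e1]
      constructor
      · rintro ⟨⟨h1, h2, h3⟩, h4, h5⟩
        refine ⟨⟨h1, by grind, by grind⟩, h2, ?_⟩
        intro a ha b hb
        by_cases hax : a = x
        · subst hax
          have := h5 b (by grind)
          grind
        · exact h3 a (by grind) b hb
      · rintro ⟨⟨h1, h2, h3⟩, h4, h5⟩
        refine ⟨⟨h1, h4, fun a ha b hb => h5 a (by grind) b hb⟩, ?_, ?_⟩
        · intro h
          rcases List.mem_append.1 h with h | h
          · exact h2 h
          · exact (h5 x (by simp) x h).1 rfl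
        · intro z hz
          rcases List.mem_append.1 hz with h | h
          · exact h3 z h
          · have := h5 x (by simp) z h
            have := h5 y (by simp) z h
            grind

theorem Linked.reverse {A B : List V} (h : Linked G A B) : Linked G B.reverse A.reverse := by
  intro b hb a ha
  have := h a (by simpa using ha) b (by simpa using hb)
  simp only [List.getLast?_reverse, List.head?_reverse]
  rw [G.adj_comm]
  tauto

theorem IndPath.reverse {l : List V} (h : IndPath G l) : IndPath G l.reverse := by
  induction l with
  | nil => simp
  | cons x l ih =>
    rw [List.reverse_cons, indPath_append]
    have h' : IndPath G ([x] ++ l) := h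
    rw [indPath_append] at h'
    exact ⟨ih h.1, by simp, by simpa using h'.2.2.reverse⟩

/-- Replacing an inner nonempty stretch of an induced path. -/
theorem IndPath.splice {A M S B : List V} (hP : IndPath G (A ++ (M ++ B))) (hM : M ≠ [])
    (hS : IndPath G S) (hS0 : S ≠ []) (hAS : Linked G A S) (hSB : Linked G S B) :
    IndPath G (A ++ (S ++ B)) := by
  rw [indPath_append, indPath_append] at hP ⊢
  obtain ⟨hA, ⟨hM', hB, hMB⟩, hAMB⟩ := hP
  obtain ⟨m, M, rfl⟩ := List.exists_cons_of_ne_nil hM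
  obtain ⟨s, S, rfl⟩ := List.exists_cons_of_ne_nil hS0
  refine ⟨hA, ⟨hS, hB, hSB⟩, ?_⟩
  intro a ha b hb
  rcases List.mem_append.1 hb with h | h
  · have := hAS a ha b h
    simpa using this
  -- As `M` and `S` are nonempty, `A` and `B` touch in neither list: the vertex following `A` is `m`
  -- in the old list and `s` in the new one, and neither equals `b`.
  · have h1 := hAMB a ha b (by simp [h])
    have h2 := hMB m (by simp) b h
    refine ⟨h1.1, ?_⟩
    rw [h1.2]
    have h3 : s ≠ b := (hSB s (by simp) b h).1
    simp [h2.1, h3]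

theorem linked_of {A B : List V} {x y : V} (hne : ∀ a ∈ A ++ [x], ∀ b ∈ y :: B, a ≠ b)
    (hxy : G.Adj x y) (h : ∀ a ∈ A ++ [x], ∀ b ∈ y :: B, G.Adj a b → a = x ∧ b = y) :
    Linked G (A ++ [x]) (y :: B) := by
  intro a ha b hb
  refine ⟨hne a ha b hb, fun hab => ?_, ?_⟩
  · obtain ⟨rfl, rfl⟩ := h a ha b hb hab
    simp
  · simp only [List.getLast?_append, List.getLast?_singleton, Option.some_or, List.head?_cons,
      Option.some.injEq]
    rintro ⟨rfl, rfl⟩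
    exact hxy

theorem IndPath.left {A B : List V} (h : IndPath G (A ++ B)) : IndPath G A :=
  (indPath_append.1 h).1

theorem IndPath.right {A B : List V} (h : IndPath G (A ++ B)) : IndPath G B :=
  (indPath_append.1 h).2.1

theorem IndPath.linked {A B : List V} (h : IndPath G (A ++ B)) : Linked G A B :=
  (indPath_append.1 h).2.2

theorem IndPath.adj {A B : List V} {x y : V} (h : IndPath G (A ++ x :: y :: B)) : G.Adj x y := by
  have := h.right.2.2 y (by simp)
  simpa using this

theorem IndPath.exists_adj {l : List V} (h : IndPath G l) (h2 : 2 ≤ l.length) {z : V}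
    (hz : z ∈ l) : ∃ z' ∈ l, G.Adj z z' := by
  obtain ⟨A, B, rfl⟩ := List.append_of_mem hz
  rcases B with _ | ⟨b, B⟩
  · rcases List.eq_nil_or_concat A with rfl | ⟨A, a, rfl⟩
    · simp at h2
    · refine ⟨a, by simp, ?_⟩
      have := (h.linked a (by simp) z (by simp)).2
      simp at this
      exact this.symm
  · refine ⟨b, by simp, ?_⟩
    have := h.right.2.2 b (by simp)
    simpa using this

/-! ### First and last occurrences; shortest paths to a set -/

theorem list_exists_first {α : Type*} (φ : α → Prop) (l : List α) (h : ∃ x ∈ l, φ x) :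
    ∃ A x B, l = A ++ x :: B ∧ φ x ∧ ∀ y ∈ A, ¬ φ y := by
  induction l with
  | nil => simp at h
  | cons z l ih =>
    by_cases hz : φ z
    · exact ⟨[], z, l, by simp, hz, by simp⟩
    · obtain ⟨A, x, B, rfl, h1, h2⟩ := ih (by grind)
      exact ⟨z :: A, x, B, by simp, h1, by grind⟩

theorem list_exists_last {α : Type*} (φ : α → Prop) (l : List α) (h : ∃ x ∈ l, φ x) :
    ∃ A x B, l = A ++ x :: B ∧ φ x ∧ ∀ y ∈ B, ¬ φ y := by
  obtain ⟨A, x, B, h1, h2, h3⟩ := list_exists_first φ l.reverse (by simpa using h)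
  refine ⟨B.reverse, x, A.reverse, ?_, h2, by simpa using h3⟩
  have := congrArg List.reverse h1
  simpa using this

/-- The vertices of a list satisfying a predicate: one, or a first and a last one. -/
theorem list_exists_first_last {α : Type*} (φ : α → Prop) (l : List α) (h : ∃ x ∈ l, φ x) :
    (∃ A x B, l = A ++ x :: B ∧ φ x ∧ (∀ y ∈ A, ¬ φ y) ∧ ∀ y ∈ B, ¬ φ y) ∨
    (∃ A x M y B, l = A ++ x :: (M ++ y :: B) ∧ φ x ∧ φ y ∧ (∀ y ∈ A, ¬ φ y) ∧
      ∀ y ∈ B, ¬ φ y) := by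
  obtain ⟨A, x, B, rfl, hx, hA⟩ := list_exists_first φ l h
  by_cases hB : ∃ y ∈ B, φ y
  · obtain ⟨M, y, B, rfl, hy, hB⟩ := list_exists_last φ B hB
    exact Or.inr ⟨A, x, M, y, B, rfl, hx, hy, hA, hB⟩
  · exact Or.inl ⟨A, x, B, rfl, hx, hA, by grind⟩

/-- The last clause is the invariant of the induction: all vertices after the first are strictly
nearer to `S`, so a chord from a new first vertex, or its repetition, would give a walk to `S` that
is too short. -/
theorem exists_indPath_of_walk (H : SimpleGraph V) (S : Set V) (n : ℕ) :
    ∀ x : V, (∃ t ∈ S, ∃ w : H.Walk x t, w.length = n + 1) →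
    (∀ t ∈ S, ∀ w : H.Walk x t, n + 1 ≤ w.length) →
    ∃ A s t, (A ++ [s]).head? = some x ∧ IndPath H (A ++ [s, t]) ∧ t ∈ S ∧
      (∀ y ∈ A ++ [s], y ∉ S) ∧ (∀ y ∈ A, ∀ t' ∈ S, ¬ H.Adj y t') ∧
      ∀ y ∈ A ++ [s, t], y ≠ x → ∃ t' ∈ S, ∃ w : H.Walk y t', w.length ≤ n := by
  induction n with
  | zero =>
    rintro x ⟨t, ht, w, hw⟩ hmin
    have hadj : H.Adj x t := Walk.adj_of_length_eq_one hw
    refine ⟨[], x, t, by simp, ?_, ht, ?_, by simp, ?_⟩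
    · simp [indPath_cons, hadj, hadj.ne]
    · simp only [List.nil_append, List.mem_singleton, forall_eq]
      intro hx
      simpa using hmin x hx Walk.nil
    · intro y hy hyx
      have : y = t := by simpa [hyx] using hy
      subst this
      exact ⟨y, ht, Walk.nil, by simp⟩
  | succ n ih =>
    rintro x ⟨t, ht, w, hw⟩ hmin
    cases w with
    | nil => simp at hw
    | @cons _ z _ hxz w =>
    have hmin' : ∀ t ∈ S, ∀ w : H.Walk z t, n + 1 ≤ w.length := by
      intro t ht w
      have := hmin t ht (Walk.cons hxz w)
      simpa using this
    obtain ⟨A, s, t', h1, h2, h3, h4, h5, h6⟩ := ih z ⟨t, ht, w, by simpa using hw⟩ hmin'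
    have key : ∀ y ∈ A ++ [s, t'], y ≠ z → ¬ H.Adj x y ∧ y ≠ x := by
      intro y hy hyz
      obtain ⟨t₁, ht₁, w₁, hw₁⟩ := h6 y hy hyz
      refine ⟨fun hxy => ?_, ?_⟩
      · have := hmin t₁ ht₁ (Walk.cons hxy w₁)
        simp at this; omega
      · rintro rfl
        have := hmin t₁ ht₁ w₁
        omega
    have hhead : (A ++ [s, t']).head? = some z := by
      rcases A with _ | ⟨a, A⟩ <;> simpa using h1
    refine ⟨x :: A, s, t', by simp, ?_, h3, ?_, ?_, ?_⟩
    · refine ⟨h2, ?_, ?_⟩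
      · intro hx
        by_cases hxz' : x = z
        · exact hxz.ne hxz'
        · exact (key x hx hxz').2 rfl
      · intro y hy
        change H.Adj x y ↔ (A ++ [s, t']).head? = some y
        rw [hhead]
        by_cases hyz : y = z
        · subst hyz; simp [hxz]
        · simp [(key y hy hyz).1, Ne.symm hyz]
    · intro y hy
      rcases List.mem_cons.1 (by simpa using hy : y ∈ x :: (A ++ [s])) with rfl | hy
      · intro hx
        simpa using hmin y hx Walk.nil
      · exact h4 y hy
    · intro y hy t₁ ht₁ hadj
      rcases List.mem_cons.1 hy with rfl | hy
      · have := hmin t₁ ht₁ (Walk.cons hadj Walk.nil)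
        simp at this
      · exact h5 y hy t₁ ht₁ hadj
    · intro y hy hyx
      by_cases hyz : y = z
      · subst hyz
        exact ⟨t, ht, w, by simpa using hw.le⟩
      · obtain ⟨t₁, ht₁, w₁, hw₁⟩ := h6 y (by simpa [hyx] using hy) hyz
        exact ⟨t₁, ht₁, w₁, by omega⟩

/-- A shortest path from `x` to the set `S`. -/
theorem exists_indPath_to_set (H : SimpleGraph V) (S : Set V) (x : V) (hx : x ∉ S)
    (h : ∃ t ∈ S, H.Reachable x t) :
    ∃ A s t, (A ++ [s]).head? = some x ∧ IndPath H (A ++ [s, t]) ∧ t ∈ S ∧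
      (∀ y ∈ A ++ [s], y ∉ S) ∧ (∀ y ∈ A, ∀ t' ∈ S, ¬ H.Adj y t') := by
  classical
  have hex : ∃ n, ∃ t ∈ S, ∃ w : H.Walk x t, w.length = n := by
    obtain ⟨t, ht, ⟨w⟩⟩ := h
    exact ⟨_, t, ht, w, rfl⟩
  have hmin : ∀ t ∈ S, ∀ w : H.Walk x t, Nat.find hex ≤ w.length :=
    fun t ht w => Nat.find_min' hex ⟨t, ht, w, rfl⟩
  have hspec := Nat.find_spec hex
  generalize Nat.find hex = m at hmin hspec
  rcases m with _ | n
  · obtain ⟨t, ht, w, hw⟩ := hspec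
    have := Walk.eq_of_length_eq_zero hw
    exact absurd (this ▸ ht) hx
  · obtain ⟨A, s, t, h1, h2, h3, h4, h5, -⟩ := exists_indPath_of_walk H S n x hspec hmin
    exact ⟨A, s, t, h1, h2, h3, h4, h5⟩

/-- The graph obtained from `G` by isolating the vertices of `K`. -/
def isolate (G : SimpleGraph V) (K : Set V) : SimpleGraph V where
  Adj x y := G.Adj x y ∧ x ∉ K ∧ y ∉ K
  symm := ⟨fun _ _ h => ⟨h.1.symm, h.2.2, h.2.1⟩⟩
  loopless := ⟨fun _ h => G.loopless.irrefl _ h.1⟩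

theorem reachable_isolate_of_walk {K : Set V} {x y : V} (w : G.Walk x y)
    (h : ∀ z ∈ w.support, z ∉ K) : (G.isolate K).Reachable x y := by
  induction w with
  | nil => exact Reachable.refl _
  | @cons a b c hab w ih =>
    have h1 : (G.isolate K).Adj a b := ⟨hab, h a (by simp), h b (by simp)⟩
    exact h1.reachable.trans (ih (fun z hz => h z (by simp [hz])))

theorem IndPath.of_isolate {K : Set V} {l : List V} (h : IndPath (G.isolate K) l)
    (hl : ∀ z ∈ l, z ∉ K) : IndPath G l := by
  induction l with
  | nil => simp
  | cons x l ih =>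
    refine ⟨ih h.1 (fun z hz => hl z (by simp [hz])), h.2.1, fun y hy => ?_⟩
    rw [← h.2.2 y hy]
    exact ⟨fun h => ⟨h, hl x (by simp), hl y (by simp [hy])⟩, fun h => h.1⟩

theorem Walk.exists_pred {x y : V} {n : ℕ} (w : G.Walk x y) (hw : w.length = n + 1) :
    ∃ z, G.Adj z y ∧ ∃ q : G.Walk x z, q.length = n := by
  have hr : w.reverse.length = n + 1 := by simpa using hw
  cases h : w.reverse with
  | nil => rw [h] at hr; simp at hr
  | @cons _ z _ hyz q =>
    rw [h] at hr
    exact ⟨z, hyz.symm, q.reverse, by simpa using hr⟩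

end

/-! ### Induced paths between leaves and their reroutings -/

section
variable {V : Type*}


/-- An induced path of `H` with both ends in `L`. -/
structure Adm (H : SimpleGraph V) (L : Set V) (P : List V) : Prop where
  ind : IndPath H P
  head : ∃ t ∈ L, P.head? = some t
  last : ∃ t ∈ L, P.getLast? = some t
  two : 2 ≤ P.length

/-- The vertices of `L` are leaves of `H`, no two of them adjacent, and no vertex of `H` has four
neighbors. -/
structure Leafy (H : SimpleGraph V) (L : Set V) : Prop where
  leaf : ∀ t ∈ L, ∀ u u', H.Adj t u → H.Adj t u' → u = u'
  indep : ∀ t ∈ L, ∀ u, H.Adj t u → u ∉ L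
  deg : ∀ x a b c d, H.Adj x a → H.Adj x b → H.Adj x c → H.Adj x d → ¬ [a, b, c, d].Nodup

/-- A pendant path `x, u, u'` attached to the path `P` at `x` only. -/
structure Pendant (H : SimpleGraph V) (L : Set V) (P : List V) (x u u' : V) : Prop where
  notMem₁ : u ∉ L
  notMem₂ : u' ∉ L
  off₁ : u ∉ P
  off₂ : u' ∉ P
  adj₁ : H.Adj x u
  adj₂ : H.Adj u u'
  only : ∀ z ∈ P, H.Adj u z → z = x
  none : ∀ z ∈ P, ¬ H.Adj u' z


variable {H : SimpleGraph V} {L : Set V}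

theorem Adm.reverse {P : List V} (h : Adm H L P) : Adm H L P.reverse :=
  ⟨h.ind.reverse, by simpa using h.last, by simpa using h.head, by simpa using h.two⟩

theorem Adm.splice {A M S B : List V} {x y : V} (hP : Adm H L (A ++ x :: (M ++ y :: B)))
    (hM : M ≠ []) (hS : IndPath H S) (hS0 : S ≠ []) (hAS : Linked H (A ++ [x]) S)
    (hSB : Linked H S (y :: B)) : Adm H L (A ++ x :: (S ++ y :: B)) := by
  have e : ∀ Z, A ++ x :: (Z ++ y :: B) = (A ++ [x]) ++ (Z ++ y :: B) := by simp
  obtain ⟨h1, h2, h3, h4⟩ := hP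
  rw [e] at h1 h2 h3 ⊢
  refine ⟨h1.splice hM hS hS0 hAS hSB, ?_, ?_, by simp; omega⟩
  · simpa using h2
  · rw [← List.append_assoc, List.getLast?_append_of_ne_nil _ (by simp)] at h3 ⊢
    exact h3

theorem Adm.tail {A S B : List V} {x t : V} (hP : Adm H L (A ++ x :: B))
    (hS : IndPath H (S ++ [t])) (hAS : Linked H (A ++ [x]) (S ++ [t])) (ht : t ∈ L) :
    Adm H L (A ++ x :: (S ++ [t])) := by
  have e : ∀ Z, A ++ x :: Z = (A ++ [x]) ++ Z := by simp
  obtain ⟨h1, h2, h3, h4⟩ := hP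
  rw [e] at h1 h2 ⊢
  refine ⟨indPath_append.2 ⟨h1.left, hS, hAS⟩, ?_, ⟨t, ht, ?_⟩, by simp; omega⟩
  · simpa using h2
  · rw [← List.append_assoc, List.getLast?_concat]

theorem Adm.nbrs {P : List V} (h : Adm H L P) {z : V} (hz : z ∈ P) :
    (z ∈ L ∧ ∃ z' ∈ P, H.Adj z z') ∨
      ∃ z₁ ∈ P, ∃ z₂ ∈ P, z₁ ≠ z₂ ∧ H.Adj z z₁ ∧ H.Adj z z₂ := by
  have hex := h.ind.exists_adj h.two hz
  obtain ⟨hi, ⟨t, ht, hh⟩, ⟨t', ht', hl⟩, h2⟩ := h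
  obtain ⟨A, B, rfl⟩ := List.append_of_mem hz
  rcases B with _ | ⟨b, B⟩
  · left
    have : z = t' := by simpa using hl
    exact ⟨this ▸ ht', hex⟩
  · rcases List.eq_nil_or_concat A with rfl | ⟨A, a, rfl⟩
    · left
      have : z = t := by simpa using hh
      exact ⟨this ▸ ht, hex⟩
    · right
      have e : A.concat a ++ z :: b :: B = A ++ a :: z :: b :: B := by simp
      rw [e] at hi
      have h1 := hi.adj
      have h3 := hi.right.1
      have h4 := IndPath.adj (A := []) h3
      have h5 := hi.right.2.1
      exact ⟨a, by simp, b, by simp, by grind, h1.symm, h4⟩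

theorem Adm.notMem_of_adj (hL : Leafy H L) {P : List V} (h : Adm H L P) {z u : V} (hz : z ∈ P)
    (hu : u ∉ P) (hzu : H.Adj z u) : z ∉ L := by
  intro hzL
  obtain ⟨z', hz', hzz'⟩ := h.ind.exists_adj h.two hz
  exact hu (hL.leaf z hzL _ _ hzu hzz' ▸ hz')

/-- A path vertex with a neighbor off the path is not a leaf, hence has two neighbors on the path,
and the degree bound leaves room for one more. -/
theorem Adm.nbr_unique (hL : Leafy H L) {P : List V} (h : Adm H L P) {z u u' : V} (hz : z ∈ P)
    (hu : u ∉ P) (hu' : u' ∉ P) (hzu : H.Adj z u) (hzu' : H.Adj z u') : u = u' := by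
  rcases h.nbrs hz with ⟨h1, -⟩ | ⟨z₁, h1, z₂, h2, h3, h4, h5⟩
  · exact absurd h1 (h.notMem_of_adj hL hz hu hzu)
  · have := hL.deg z z₁ z₂ u u' h4 h5 hzu hzu'
    by_contra hne
    apply this
    simp
    grind

/-- The empty clique yields a leaf `t₁` reachable from `v`, and the clique `{t₁}` yields a second
one; a shortest path of `H` between them is induced. -/
theorem exists_adm (v : V) (hv : v ∉ L)
    (hK : ∀ K : Set V, H.IsClique K → v ∉ K → ∃ t ∈ L, t ∉ K ∧ (H.isolate K).Reachable v t) :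
    ∃ P, Adm H L P ∧ ∃ x ∈ P, H.Reachable v x := by
  have hle : ∀ K, H.isolate K ≤ H := fun K x y h => h.1
  obtain ⟨t₁, h1, -, r1⟩ := hK ∅ (by simp) (by simp)
  obtain ⟨t₂, h2, hne, r2⟩ := hK {t₁} (by simp) (by simp; rintro rfl; exact hv h1)
  have r1 := r1.mono (hle _)
  have r2 := r2.mono (hle _)
  obtain ⟨A, s, t, h3, h4, h5, -⟩ := exists_indPath_to_set H {t₂} t₁
    (fun h => hne (by simpa using h.symm)) ⟨t₂, rfl, r1.symm.trans r2⟩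
  have h5 : t = t₂ := h5
  subst h5
  have hh : (A ++ [s, t]).head? = some t₁ := by
    rcases A with _ | ⟨a, A⟩ <;> simpa using h3
  exact ⟨A ++ [s, t], ⟨h4, ⟨t₁, h1, hh⟩, ⟨t, h2, by simp⟩, by simp⟩, t₁,
    List.mem_of_head? hh, r1⟩

theorem linked_left {A B S : List V} {p u : V} (hup : H.Adj u p)
    (hout : ∀ z ∈ u :: S, z ∉ A ++ p :: B) (hA : ∀ z ∈ u :: S, ∀ a ∈ A, ¬ H.Adj z a)
    (hp : ∀ z ∈ S, ¬ H.Adj z p) : Linked H (A ++ [p]) (u :: S) := by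
  refine linked_of ?_ hup.symm ?_
  · rintro a ha z hz rfl
    exact hout a hz (by simp at ha ⊢; tauto)
  · intro a ha z hz haz
    rcases List.mem_append.1 ha with h | h
    · exact absurd haz.symm (hA z hz a h)
    · have : a = p := by simpa using h
      subst this
      rcases List.mem_cons.1 hz with h | h
      · exact ⟨rfl, h⟩
      · exact absurd haz.symm (hp z h)

theorem linked_right {A B S : List V} {q u : V} (huq : H.Adj u q)
    (hout : ∀ z ∈ S ++ [u], z ∉ A ++ q :: B) (hB : ∀ z ∈ S ++ [u], ∀ a ∈ B, ¬ H.Adj z a)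
    (hq : ∀ z ∈ S, ¬ H.Adj z q) : Linked H (S ++ [u]) (q :: B) := by
  refine linked_of ?_ huq ?_
  · rintro z hz a ha rfl
    exact hout z hz (by simp at ha ⊢; tauto)
  · intro z hz a ha haz
    rcases List.mem_cons.1 ha with rfl | h
    · rcases List.mem_append.1 hz with h | h
      · exact absurd haz (hq z h)
      · exact ⟨by simpa using h, rfl⟩
    · exact absurd haz (hB z hz a h)

/-- Rerouting a path through a single vertex `u` that carries a pendant path. -/
theorem Adm.splice_pendant {A M B : List V} {p q u v u' : V}
    (hP : Adm H L (A ++ p :: (M ++ q :: B))) (hM : M ≠ []) (hv : v ∉ L) (hu' : u' ∉ L)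
    (hvP : v ∉ A ++ p :: (M ++ q :: B)) (huP : u ∉ A ++ p :: (M ++ q :: B))
    (huP' : u' ∉ A ++ p :: (M ++ q :: B)) (huv : H.Adj u v) (hvu' : H.Adj v u')
    (huu : ¬ H.Adj u u') (hne : u ≠ u') (hup : H.Adj u p) (huq : H.Adj u q)
    (hA : ∀ z ∈ A, ¬ H.Adj v z ∧ ¬ H.Adj u z ∧ ¬ H.Adj u' z)
    (hB : ∀ z ∈ B, ¬ H.Adj v z ∧ ¬ H.Adj u z ∧ ¬ H.Adj u' z)
    (hp : ¬ H.Adj v p ∧ ¬ H.Adj u' p) (hq : ¬ H.Adj v q ∧ ¬ H.Adj u' q) :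
    ∃ P, Adm H L P ∧ ∃ x ∈ P, ∃ u u', Pendant H L P x u u' := by
  have l1 : Linked H (A ++ [p]) [u] := linked_left hup (B := M ++ q :: B) (by simpa using huP)
    (fun z hz a ha => by simp at hz; subst hz; exact (hA a ha).2.1) (by simp)
  have l2 : Linked H ([] ++ [u]) (q :: B) := linked_right huq (A := A ++ p :: M)
    (by simpa using huP)
    (fun z hz a ha => by simp at hz; subst hz; exact (hB a ha).2.1) (by simp)
  have hmem : ∀ z, z ∈ A ++ p :: ([u] ++ q :: B) ↔ z ∈ A ∨ z = p ∨ z = u ∨ z = q ∨ z ∈ B := by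
    simp
  simp only [List.mem_append, List.mem_cons, not_or] at hvP huP huP'
  refine ⟨_, hP.splice hM (indPath_singleton u) (by simp) l1 l2, u, by simp, v, u', hv, hu',
    ?_, ?_, huv, hvu', ?_, ?_⟩
  · rw [hmem]
    have := huv.ne'
    tauto
  · rw [hmem]
    have := hne.symm
    tauto
  · intro z hz
    rw [hmem] at hz
    rcases hz with h | rfl | rfl | rfl | h
    · exact fun h' => absurd h' (hA z h).1
    · exact fun h' => absurd h' hp.1
    · exact fun _ => rfl
    · exact fun h' => absurd h' hq.1
    · exact fun h' => absurd h' (hB z h).1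
  · intro z hz
    rw [hmem] at hz
    rcases hz with h | rfl | rfl | rfl | h
    · exact (hA z h).2.2
    · exact hp.2
    · exact fun h => huu h.symm
    · exact hq.2
    · exact (hB z h).2.2

/-- Here `p` and `q` are the first and last path vertices attached to the induced path `b, v, c`. If
`p` and `q` attach to different vertices of it, the detour from `p` to `q` can be led through `v`.
If both attach to `b`, the detour through `b` carries the pendant path `b, v, c`; symmetrically for
`c`. -/
theorem Adm.of_first_last (hL : Leafy H L) {A M B : List V} {p q v b c : V}
    (hP : Adm H L (A ++ p :: (M ++ q :: B))) (hv : v ∉ L) (hbL : b ∉ L) (hcL : c ∉ L)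
    (hvP : v ∉ A ++ p :: (M ++ q :: B)) (hbP : b ∉ A ++ p :: (M ++ q :: B))
    (hcP : c ∉ A ++ p :: (M ++ q :: B)) (hb : H.Adj v b) (hc : H.Adj v c)
    (hbc : b ≠ c) (nbc : ¬ H.Adj b c) (hM : M ≠ [])
    (hp : H.Adj v p ∨ H.Adj b p ∨ H.Adj c p) (hq : H.Adj v q ∨ H.Adj b q ∨ H.Adj c q)
    (hvv : H.Adj v p → ¬ H.Adj v q)
    (hA : ∀ y ∈ A, ¬ H.Adj v y ∧ ¬ H.Adj b y ∧ ¬ H.Adj c y)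
    (hB : ∀ y ∈ B, ¬ H.Adj v y ∧ ¬ H.Adj b y ∧ ¬ H.Adj c y) :
    ∃ P, Adm H L P ∧ (v ∈ P ∨ ∃ x ∈ P, ∃ u u', Pendant H L P x u u') := by
  have hvb := hb.ne
  have hvc := hc.ne
  have ncb : ¬ H.Adj c b := fun h => nbc h.symm
  have uniq : ∀ z ∈ A ++ p :: (M ++ q :: B), ∀ u u', u ∉ A ++ p :: (M ++ q :: B) →
      u' ∉ A ++ p :: (M ++ q :: B) → u ≠ u' → H.Adj u z → ¬ H.Adj u' z :=
    fun z hz u u' hu hu' hne h h' => hne (hP.nbr_unique hL hz hu hu' h.symm h'.symm)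
  have hpm : p ∈ A ++ p :: (M ++ q :: B) := by simp
  have hqm : q ∈ A ++ p :: (M ++ q :: B) := by simp
  have pvb := uniq p hpm v b hvP hbP hvb
  have pvc := uniq p hpm v c hvP hcP hvc
  have pbc := uniq p hpm b c hbP hcP hbc
  have qvb := uniq q hqm v b hvP hbP hvb
  have qvc := uniq q hqm v c hvP hcP hvc
  have qbc := uniq q hqm b c hbP hcP hbc
  clear uniq
  -- The detour is presented both by its first vertex, `u :: S'`, and by its last, `S ++ [u']`, to
  -- match the two linking lemmas.
  have through : ∀ u u' S S', u :: S' = S ++ [u'] → IndPath H (S ++ [u']) → v ∈ S ++ [u'] →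
      (∀ z ∈ S ++ [u'], z = v ∨ z = b ∨ z = c) → H.Adj u p → H.Adj u' q →
      (∀ z ∈ S', ¬ H.Adj z p) → (∀ z ∈ S, ¬ H.Adj z q) →
      ∃ P, Adm H L P ∧ (v ∈ P ∨ ∃ x ∈ P, ∃ u u', Pendant H L P x u u') := by
    intro u u' S S' he hi hvm hS hup huq hp hq
    have hout : ∀ z ∈ S ++ [u'], z ∉ A ++ p :: (M ++ q :: B) := by
      intro z hz
      rcases hS z hz with rfl | rfl | rfl <;> assumption
    have hA' : ∀ z ∈ S ++ [u'], ∀ a ∈ A, ¬ H.Adj z a := by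
      intro z hz a ha
      obtain ⟨h1, h2, h3⟩ := hA a ha
      rcases hS z hz with rfl | rfl | rfl <;> assumption
    have hB' : ∀ z ∈ S ++ [u'], ∀ a ∈ B, ¬ H.Adj z a := by
      intro z hz a ha
      obtain ⟨h1, h2, h3⟩ := hB a ha
      rcases hS z hz with rfl | rfl | rfl <;> assumption
    have l2 : Linked H (S ++ [u']) (q :: B) :=
      linked_right huq (A := A ++ p :: M) (by simpa using hout) hB' hq
    have l1 : Linked H (A ++ [p]) (S ++ [u']) := by
      rw [← he] at hout hA' ⊢
      exact linked_left hup hout hA' hp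
    exact ⟨_, hP.splice hM hi (by simp) l1 l2, Or.inl
      (List.mem_append_right _ (List.mem_cons_of_mem _ (List.mem_append_left _ hvm)))⟩
  have pend : (∃ Q, Adm H L Q ∧ ∃ x ∈ Q, ∃ u u', Pendant H L Q x u u') →
      ∃ Q, Adm H L Q ∧ (v ∈ Q ∨ ∃ x ∈ Q, ∃ u u', Pendant H L Q x u u') :=
    fun ⟨Q, h1, h2⟩ => ⟨Q, h1, Or.inr h2⟩
  rcases hp with hp | hp | hp <;> rcases hq with hq | hq | hq
  · exact absurd hq (hvv hp)
  · exact through v b [v] [b] rfl (by simp [indPath_cons, hb, hvb]) (by simp) (by simp) hp hq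
      (by simpa using pvb hp) (by simpa using fun h => qvb h hq)
  · exact through v c [v] [c] rfl (by simp [indPath_cons, hc, hvc]) (by simp) (by simp) hp hq
      (by simpa using pvc hp) (by simpa using fun h => qvc h hq)
  · exact through b v [b] [v] rfl (by simp [indPath_cons, hb.symm, hvb.symm]) (by simp) (by simp)
      hp hq (by simpa using fun h => pvb h hp) (by simpa using qvb hq)
  · exact pend (hP.splice_pendant hM hv hcL hvP hbP hcP hb.symm hc nbc hbc hp hq hA hB
      ⟨fun h => pvb h hp, pbc hp⟩ ⟨fun h => qvb h hq, qbc hq⟩)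
  · exact through b c [b, v] [v, c] rfl
      (by simp [indPath_cons, hb.symm, hvb.symm, hbc, hc, hvc, nbc]) (by simp) (by simp)
      hp hq (by simpa using ⟨fun h => pvb h hp, pbc hp⟩)
      (by simpa using ⟨fun h => qbc h hq, fun h => qvc h hq⟩)
  · exact through c v [c] [v] rfl (by simp [indPath_cons, hc.symm, hvc.symm]) (by simp) (by simp)
      hp hq (by simpa using fun h => pvc h hp) (by simpa using qvc hq)
  · exact through c b [c, v] [v, b] rfl
      (by simp [indPath_cons, hc.symm, hvc.symm, hbc.symm, hb, hvb, ncb]) (by simp) (by simp)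
      hp hq (by simpa using ⟨fun h => pvc h hp, fun h => pbc h hp⟩)
      (by simpa using ⟨qbc hq, fun h => qvb h hq⟩)
  · exact pend (hP.splice_pendant hM hv hbL hvP hcP hbP hc.symm hb ncb hbc.symm hp hq
      (fun z hz => ⟨(hA z hz).1, (hA z hz).2.2, (hA z hz).2.1⟩)
      (fun z hz => ⟨(hB z hz).1, (hB z hz).2.2, (hB z hz).2.1⟩)
      ⟨fun h => pvc h hp, fun h => pbc h hp⟩ ⟨fun h => qvc h hq, fun h => qbc h hq⟩)

/-- If `v` has exactly one neighbor on the path `P`, a path through `v` or a pendant path at a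
vertex of a path exists. -/
theorem Adm.of_single (hL : Leafy H L) {A B : List V} {v x b c : V} (hP : Adm H L (A ++ x :: B))
    (hv : v ∉ L) (hvP : v ∉ A ++ x :: B) (hvx : H.Adj v x) (hA : ∀ z ∈ A, ¬ H.Adj v z)
    (hB : ∀ z ∈ B, ¬ H.Adj v z) (hb : H.Adj v b) (hc : H.Adj v c) (hbx : b ≠ x) (hcx : c ≠ x)
    (hbc : b ≠ c) (nbc : ¬ H.Adj b c) (nbx : ¬ H.Adj b x) (ncx : ¬ H.Adj c x) :
    ∃ P, Adm H L P ∧ (v ∈ P ∨ ∃ x ∈ P, ∃ u u', Pendant H L P x u u') := by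
  have hbP : b ∉ A ++ x :: B := by grind
  have hcP : c ∉ A ++ x :: B := by grind
  -- If `b` is a leaf, the path can end in `x, v, b`; if `b` has no neighbor on the path, `x, v, b`
  -- is pendant. What remains is that both `b` and `c` are attached to the path.
  have hone : ∀ b, H.Adj v b → b ≠ x → ¬ H.Adj b x → b ∉ A ++ x :: B →
      (∃ P, Adm H L P ∧ (v ∈ P ∨ ∃ x ∈ P, ∃ u u', Pendant H L P x u u')) ∨
      b ∉ L ∧ ∃ z ∈ A ++ x :: B, H.Adj b z := by
    intro b hb hbx nbx hbP
    by_cases hbL : b ∈ L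
    · left
      have hlink : Linked H (A ++ [x]) ([v] ++ [b]) := by
        change Linked H (A ++ [x]) [v, b]
        refine linked_of (by grind) hvx.symm ?_
        intro a ha d hd had
        have := hL.leaf b hbL v a hb.symm
        have := hA a
        have := had.symm
        grind
      exact ⟨A ++ x :: ([v] ++ [b]), hP.tail (by simp [indPath_cons, hb, hb.ne]) hlink hbL,
        Or.inl (by simp)⟩
    · by_cases hz : ∃ z ∈ A ++ x :: B, H.Adj b z
      · exact Or.inr ⟨hbL, hz⟩
      · left
        push Not at hz
        exact ⟨_, hP, Or.inr ⟨x, by simp, v, b, hv, hbL, hvP, hbP, hvx.symm, hb, by grind, hz⟩⟩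
  obtain h | ⟨hbL, zb, hzb, hbzb⟩ := hone b hb hbx nbx hbP
  · exact h
  obtain h | ⟨hcL, zc, hzc, hczc⟩ := hone c hc hcx ncx hcP
  · exact h
  have huniq : ∀ z ∈ A ++ x :: B, ∀ u u', u ∉ A ++ x :: B → u' ∉ A ++ x :: B → H.Adj u z →
      H.Adj u' z → u = u' := fun z hz u u' hu hu' h h' =>
    hP.nbr_unique hL hz hu hu' h.symm h'.symm
  have hvz : ∀ z ∈ A ++ x :: B, H.Adj v z → z = x := by grind
  have hxm : x ∈ A ++ x :: B := by simp
  generalize A ++ x :: B = P at *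
  clear hA hB hone
  have hvb := hb.ne
  have hvc := hc.ne
  rcases list_exists_first_last (fun z => H.Adj v z ∨ H.Adj b z ∨ H.Adj c z) P
    ⟨x, hxm, Or.inl hvx⟩ with ⟨A, p, B, rfl, hp, hA, hB⟩ | ⟨A, p, M, q, B, rfl, hp, hq, hA, hB⟩
  · exfalso
    have h1 : x = p := by grind
    have h2 : zb = p := by grind
    grind
  have hxz : x ≠ zb := by rintro rfl; exact nbx hbzb
  have hxc : x ≠ zc := by rintro rfl; exact ncx hczc
  have hzz : zb ≠ zc := by rintro rfl; exact hbc (huniq zb hzb b c hbP hcP hbzb hczc)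
  -- The attachments `x`, `zb`, `zc` of `v`, `b`, `c` are distinct, so they do not all fit into `{p,
  -- q}`.
  have hM : M ≠ [] := by
    rintro rfl
    have h1 : ∀ z ∈ A ++ p :: ([] ++ q :: B), (H.Adj v z ∨ H.Adj b z ∨ H.Adj c z) → z = p ∨ z = q := by
      intro z hz h
      have := hA z
      have := hB z
      grind
    have := h1 x hxm (Or.inl hvx)
    have := h1 zb hzb (Or.inr (Or.inl hbzb))
    have := h1 zc hzc (Or.inr (Or.inr hczc))
    grind
  have hpq : p ≠ q := by
    have := hP.ind.right.2.1
    grind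
  exact hP.of_first_last hL hv hbL hcL hvP hbP hcP hb hc hbc nbc hM hp hq (by grind)
    (fun z hz => by simpa using hA z hz) (fun z hz => by simpa using hB z hz)

/-- The new path leaves the old one at the first neighbor of `s` in `A`, runs backwards from `s` to
`w`, and rejoins at `y`. It bypasses `x`, which may be adjacent to `w`. -/
theorem Adm.reroute_left {A B A₁ : List V} {x y w s : V} (hP : Adm H L (A ++ x :: y :: B))
    (hQ : IndPath H (A₁ ++ [s])) (hhead : (A₁ ++ [s]).head? = some w)
    (hout : ∀ z ∈ A₁ ++ [s], z ∉ A ++ x :: y :: B) (hs : ∃ a ∈ A, H.Adj s a)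
    (hA : ∀ z ∈ A₁, ∀ a ∈ A, ¬ H.Adj z a) (hB : ∀ z ∈ A₁ ++ [s], ∀ b ∈ B, ¬ H.Adj z b)
    (hwy : H.Adj w y) (hy : ∀ z ∈ A₁ ++ [s], H.Adj z y → z = w) : ∃ P, Adm H L P ∧ w ∈ P := by
  obtain ⟨A', a, A'', rfl, hsa, hfirst⟩ := list_exists_first (H.Adj s) A hs
  obtain ⟨R, hR⟩ := List.head?_eq_some_iff.1 hhead
  have e1 : (A₁ ++ [s]).reverse = s :: A₁.reverse := by simp
  have e2 : (A₁ ++ [s]).reverse = R.reverse ++ [w] := by rw [hR]; simp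
  have e3 : (A' ++ a :: A'') ++ x :: y :: B = A' ++ a :: ((A'' ++ [x]) ++ y :: B) := by simp
  have e4 : (A' ++ a :: A'') ++ x :: y :: B = (A' ++ a :: A'' ++ [x]) ++ y :: B := by simp
  have hw : w ∉ R := by rw [hR] at hQ; exact hQ.2.1
  have hmem : ∀ z, z ∈ (A₁ ++ [s]).reverse ↔ z ∈ A₁ ++ [s] := fun z => List.mem_reverse
  have l1 : Linked H (A' ++ [a]) (A₁ ++ [s]).reverse := by
    rw [e1]
    refine linked_left hsa (B := (A'' ++ [x]) ++ y :: B) ?_ ?_ ?_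
    · intro z hz
      rw [← e1, hmem] at hz
      rw [← e3]
      exact hout z hz
    · intro z hz b hb
      rcases List.mem_cons.1 hz with rfl | hz
      · exact hfirst b hb
      · exact hA z (by simpa using hz) b (by simp [hb])
    · intro z hz
      exact hA z (by simpa using hz) a (by simp)
  have l2 : Linked H (A₁ ++ [s]).reverse (y :: B) := by
    rw [e2]
    refine linked_right hwy (A := A' ++ a :: A'' ++ [x]) ?_ ?_ ?_
    · intro z hz
      rw [← e2, hmem] at hz
      rw [← e4]
      exact hout z hz
    · intro z hz b hb
      rw [← e2, hmem] at hz
      exact hB z hz b hb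
    · intro z hz hzy
      have hz' : z ∈ R := by simpa using hz
      have := hy z (by rw [hR]; simp [hz']) hzy
      exact hw (this ▸ hz')
  rw [e3] at hP
  refine ⟨_, hP.splice (by simp) hQ.reverse (by simp) l1 l2, ?_⟩
  rw [e2]
  simp

/-- Take a shortest route from `w`, avoiding `x` and `y`, to a leaf or to the rest of the path, and
let `s` be its last vertex before the target. If `s` has no neighbor on the rest of the path, the
route ends in a leaf and replaces the part after `x`. If `s` has neighbors on one side only,
rerouting leads through `w`. If it has neighbors on both sides, the path is rerouted through `s`
alone, and the route behind `s` is pendant. -/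
theorem Adm.of_triangle (hL : Leafy H L) {A B : List V} {x y w r : V}
    (hP : Adm H L (A ++ x :: y :: B)) (hw : w ∉ A ++ x :: y :: B) (hwx : H.Adj w x)
    (hwy : H.Adj w y) (hwP : ∀ z ∈ A ++ x :: y :: B, H.Adj w z → z = x ∨ z = y)
    (hwr : H.Adj w r) (hrP : r ∉ A ++ x :: y :: B) (hrn : ∀ z ∈ A ++ x :: y :: B, ¬ H.Adj r z)
    (hreach : ∃ t ∈ L, t ∉ ({x, y} : Set V) ∧ (H.isolate {x, y}).Reachable w t) :
    ∃ P, Adm H L P ∧ (w ∈ P ∨ ∃ x ∈ P, ∃ u u', Pendant H L P x u u') := by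
  obtain ⟨t₀, ht₀, ht₀', hreach⟩ := hreach
  have hxP : x ∈ A ++ x :: y :: B := by simp
  have hyP : y ∈ A ++ x :: y :: B := by simp
  have hxy : x ≠ y := hP.ind.adj.ne
  have hwL : w ∉ L := fun h => hxy (hL.leaf w h x y hwx hwy)
  have hAP : ∀ z ∈ A, z ∈ A ++ x :: y :: B ∧ z ∉ ({x, y} : Set V) := by
    intro z hz
    have h1 := hP.ind.linked z hz x (by simp)
    have h2 := hP.ind.linked z hz y (by simp)
    exact ⟨by simp [hz], by simp [h1.1, h2.1]⟩
  have hBP : ∀ z ∈ B, z ∈ A ++ x :: y :: B ∧ z ∉ ({x, y} : Set V) := by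
    intro z hz
    have h1 := hP.ind.right.2.1
    have h2 := hP.ind.right.1.2.1
    refine ⟨by simp [hz], ?_⟩
    simp only [Set.mem_insert_iff, Set.mem_singleton_iff, not_or]
    constructor
    · rintro rfl; exact h1 (by simp [hz])
    · rintro rfl; exact h2 hz
  set S : Set V := {z | (z ∈ L ∨ z ∈ A ++ x :: y :: B) ∧ z ∉ ({x, y} : Set V)} with hS
  obtain ⟨A₁, s, t, hhead, hi, ht, hQS, hA₁⟩ := exists_indPath_to_set (H.isolate {x, y}) S w
    (fun h => h.1.elim hwL hw) ⟨t₀, ⟨Or.inl ht₀, ht₀'⟩, hreach⟩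
  have hK : ∀ z ∈ A₁ ++ [s, t], z ∉ ({x, y} : Set V) := by
    intro z hz
    obtain ⟨z', -, h⟩ := hi.exists_adj (by simp) hz
    exact h.2.1
  have hiH : IndPath H (A₁ ++ [s, t]) := hi.of_isolate hK
  have eQ : A₁ ++ [s, t] = (A₁ ++ [s]) ++ [t] := by simp
  have hQi : IndPath H (A₁ ++ [s]) := by rw [eQ] at hiH; exact hiH.left
  have hKQ : ∀ z ∈ A₁ ++ [s], z ∉ ({x, y} : Set V) := fun z hz => hK z (by rw [eQ]; exact List.mem_append_left _ hz)
  have hQP : ∀ z ∈ A₁ ++ [s], z ∉ A ++ x :: y :: B :=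
    fun z hz h => hQS z hz ⟨Or.inr h, hKQ z hz⟩
  have hQL : ∀ z ∈ A₁ ++ [s], z ∉ L := fun z hz h => hQS z hz ⟨Or.inl h, hKQ z hz⟩
  have hA₁n : ∀ z ∈ A₁, ∀ p ∈ A ++ x :: y :: B, p ∉ ({x, y} : Set V) → ¬ H.Adj z p := by
    intro z hz p hp hpK h
    exact hA₁ z hz p ⟨Or.inr hp, hpK⟩ ⟨h, hKQ z (by simp [hz]), hpK⟩
  have hQx : ∀ z ∈ A₁ ++ [s], H.Adj z x → z = w := fun z hz h =>
    hP.nbr_unique hL hxP (hQP z hz) hw h.symm hwx.symm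
  have hQy : ∀ z ∈ A₁ ++ [s], H.Adj z y → z = w := fun z hz h =>
    hP.nbr_unique hL hyP (hQP z hz) hw h.symm hwy.symm
  have hst : H.Adj s t := hiH.adj
  have hwm : w ∈ A₁ ++ [s] := List.mem_of_head? hhead
  by_cases hsP : ∃ p ∈ A ++ x :: y :: B, p ∉ ({x, y} : Set V) ∧ H.Adj s p
  · have hsw : s ≠ w := by
      rintro rfl
      obtain ⟨p, hp, hpK, h⟩ := hsP
      exact hpK (by simpa using hwP p hp h)
    have hsx : ¬ H.Adj s x := fun h => hsw (hQx s (by simp) h)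
    have hsy : ¬ H.Adj s y := fun h => hsw (hQy s (by simp) h)
    by_cases hsA : ∃ a ∈ A, H.Adj s a
    · by_cases hsB : ∃ b ∈ B, H.Adj s b
      · obtain ⟨A', a, A'', rfl, hsa, hA'⟩ := list_exists_first (H.Adj s) A hsA
        obtain ⟨B', b, B'', rfl, hsb, hB''⟩ := list_exists_last (H.Adj s) B hsB
        have e : (A' ++ a :: A'') ++ x :: y :: (B' ++ b :: B'') =
          A' ++ a :: ((A'' ++ x :: y :: B') ++ b :: B'') := by simp
        obtain ⟨R, hR⟩ := List.head?_eq_some_iff.1 hhead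
        rcases List.eq_nil_or_concat A₁ with rfl | ⟨A₂, u, rfl⟩
        · simp at hR
          exact absurd hR.1 hsw
        -- A pendant path at `s` needs two route vertices before `s`. If `w` were the only one, it
        -- would have the four neighbors `x`, `y`, `r`, `s`.
        rcases List.eq_nil_or_concat A₂ with rfl | ⟨A₃, u', rfl⟩
        · exfalso
          have hu : u = w := by simp at hR; exact hR.1
          subst hu
          have hus : H.Adj u s := IndPath.adj (A := []) (B := []) (by simpa using hQi)
          have hne : r ≠ s := by
            rintro rfl
            exact hrn a (by simp) hsa
          have h1 : s ∉ ({x, y} : Set V) := hKQ s (by simp)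
          have h2 : r ≠ x := by rintro rfl; exact hrP hxP
          have h3 : r ≠ y := by rintro rfl; exact hrP hyP
          refine hL.deg u x y r s hwx hwy hwr hus ?_
          simp at h1 ⊢
          exact ⟨⟨hxy, h2.symm, fun h => h1.1 h.symm⟩, ⟨h3.symm, fun h => h1.2 h.symm⟩, hne⟩
        · have eA : (A₃.concat u').concat u ++ [s] = A₃ ++ u' :: u :: [s] := by simp
          have huu : H.Adj u' u := by rw [eA] at hQi; exact hQi.adj
          have hus : H.Adj u s := by
            rw [eA] at hQi
            exact IndPath.adj (A := []) (B := []) hQi.right.1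
          have hus' : ¬ H.Adj s u' ∧ s ≠ u' := by
            rw [eA] at hQi
            have h1 := hQi.right.2.2 s (by simp)
            have h2 := hQi.right.2.1
            refine ⟨fun h => ?_, fun h => h2 (by simp [h])⟩
            have := h1.1 h.symm
            simp at this
            exact hus.ne this
          have hum : u ∈ (A₃.concat u').concat u := by simp
          have hum' : u' ∈ (A₃.concat u').concat u := by simp
          rw [e] at hP hQP
          obtain ⟨Q, h1, h2⟩ := hP.splice_pendant (u := s) (v := u) (u' := u') (by simp)
            (hQL u (by simp)) (hQL u' (by simp)) (hQP u (by simp)) (hQP s (by simp))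
            (hQP u' (by simp)) hus.symm huu.symm hus'.1 hus'.2 hsa hsb
            (fun z hz => ⟨hA₁n u hum z (by simp [hz]) (hAP z (by simp [hz])).2, hA' z hz,
              hA₁n u' hum' z (by simp [hz]) (hAP z (by simp [hz])).2⟩)
            (fun z hz => ⟨hA₁n u hum z (by simp [hz]) (hBP z (by simp [hz])).2, hB'' z hz,
              hA₁n u' hum' z (by simp [hz]) (hBP z (by simp [hz])).2⟩)
            ⟨hA₁n u hum a (by simp) (hAP a (by simp)).2,
              hA₁n u' hum' a (by simp) (hAP a (by simp)).2⟩
            ⟨hA₁n u hum b (by simp) (hBP b (by simp)).2,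
              hA₁n u' hum' b (by simp) (hBP b (by simp)).2⟩
          exact ⟨Q, h1, Or.inr h2⟩
      · obtain ⟨Q, h1, h2⟩ := hP.reroute_left hQi hhead hQP hsA
          (fun z hz a ha => hA₁n z hz a (hAP a ha).1 (hAP a ha).2)
          (fun z hz b hb h => by
            rcases List.mem_append.1 hz with hz | hz
            · exact hA₁n z hz b (hBP b hb).1 (hBP b hb).2 h
            · have : z = s := by simpa using hz
              subst this
              exact hsB ⟨b, hb, h⟩) hwy hQy
        exact ⟨Q, h1, Or.inl h2⟩
    · have e : (A ++ x :: y :: B).reverse = B.reverse ++ y :: x :: A.reverse := by simp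
      have hPr := hP.reverse
      rw [e] at hPr
      obtain ⟨Q, h1, h2⟩ := hPr.reroute_left hQi hhead
        (fun z hz => by rw [← e, List.mem_reverse]; exact hQP z hz)
        (by
          obtain ⟨p, hp, hpK, h⟩ := hsP
          refine ⟨p, ?_, h⟩
          simp only [Set.mem_insert_iff, Set.mem_singleton_iff, not_or] at hpK
          simp only [List.mem_append, List.mem_cons] at hp
          rw [List.mem_reverse]
          rcases hp with hp | hp | hp | hp
          · exact absurd ⟨p, hp, h⟩ hsA
          · exact absurd hp hpK.1
          · exact absurd hp hpK.2
          · exact hp)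
        (fun z hz a ha => by
          rw [List.mem_reverse] at ha
          exact hA₁n z hz a (hBP a ha).1 (hBP a ha).2)
        (fun z hz b hb h => by
          rw [List.mem_reverse] at hb
          rcases List.mem_append.1 hz with hz | hz
          · exact hA₁n z hz b (hAP b hb).1 (hAP b hb).2 h
          · have : z = s := by simpa using hz
            subst this
            exact hsA ⟨b, hb, h⟩) hwx hQx
      exact ⟨Q, h1, Or.inl h2⟩
  · have htL : t ∈ L := ht.1.resolve_right fun h => hsP ⟨t, h, ht.2, hst⟩
    have htP : t ∉ A ++ x :: y :: B := fun h => hsP ⟨t, h, ht.2, hst⟩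
    obtain ⟨R, hR⟩ := List.head?_eq_some_iff.1 hhead
    have hw' : w ∉ R := by rw [hR] at hQi; exact hQi.2.1
    have e1 : (A₁ ++ [s]) ++ [t] = w :: (R ++ [t]) := by rw [hR]; simp
    have hsm : s ∈ A₁ ++ [s] := by simp
    have htz : ∀ z ∈ A ++ x :: y :: B, ¬ H.Adj t z := by
      intro z hz h
      have := hL.leaf t htL z s h hst.symm
      exact hQP s hsm (this ▸ hz)
    have l1 : Linked H (A ++ [x]) ((A₁ ++ [s]) ++ [t]) := by
      rw [e1]
      refine linked_left hwx (B := y :: B) ?_ ?_ ?_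
      · intro z hz
        rw [← e1] at hz
        rcases List.mem_append.1 hz with hz | hz
        · exact hQP z hz
        · have : z = t := by simpa using hz
          exact this ▸ htP
      · intro z hz a ha h
        rw [← e1] at hz
        rcases List.mem_append.1 hz with hz | hz
        · rcases List.mem_append.1 hz with hz | hz
          · exact hA₁n z hz a (hAP a ha).1 (hAP a ha).2 h
          · have : z = s := by simpa using hz
            subst this
            exact hsP ⟨a, (hAP a ha).1, (hAP a ha).2, h⟩
        · have : z = t := by simpa using hz
          subst this
          exact htz a (hAP a ha).1 h
      · intro z hz h
        rcases List.mem_append.1 hz with hz | hz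
        · have := hQx z (by rw [hR]; simp [hz]) h
          exact hw' (this ▸ hz)
        · have : z = t := by simpa using hz
          subst this
          exact htz x hxP h
    rw [eQ] at hiH
    refine ⟨_, hP.tail hiH l1 htL, Or.inl ?_⟩
    exact List.mem_append_right _ (List.mem_cons_of_mem _ (List.mem_append_left _ hwm))

/-- In a graph in which no clique separates `v` from the set `L` of leaves, some induced path
between two leaves passes through `v` or carries a pendant path. -/
theorem exists_adm_center (hL : Leafy H L) {v : V} (hv : v ∉ L)
    (hv3 : ∀ x, H.Adj v x → ∃ b c, H.Adj v b ∧ H.Adj v c ∧ b ≠ x ∧ c ≠ x ∧ b ≠ c ∧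
      ¬ H.Adj b c ∧ ¬ H.Adj b x ∧ ¬ H.Adj c x)
    (hK : ∀ K : Set V, H.IsClique K → v ∉ K → ∃ t ∈ L, t ∉ K ∧ (H.isolate K).Reachable v t) :
    ∃ P, Adm H L P ∧ (v ∈ P ∨ ∃ x ∈ P, ∃ u u', Pendant H L P x u u') := by
  classical
  -- The path is chosen at minimal distance from `v` among all admissible paths.
  have hex : ∃ d, ∃ P, Adm H L P ∧ ∃ x ∈ P, ∃ w : H.Walk v x, w.length = d := by
    obtain ⟨P, h1, x, h2, ⟨w⟩⟩ := exists_adm v hv hK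
    exact ⟨_, P, h1, x, h2, w, rfl⟩
  have hmin : ∀ P, Adm H L P → ∀ x ∈ P, ∀ w : H.Walk v x, Nat.find hex ≤ w.length :=
    fun P h1 x h2 w => Nat.find_min' hex ⟨P, h1, x, h2, w, rfl⟩
  obtain ⟨P, hP, x₀, hx₀, w₀, hw₀⟩ := Nat.find_spec hex
  generalize Nat.find hex = d at *
  rcases d with _ | e
  · have := Walk.eq_of_length_eq_zero hw₀
    exact ⟨P, hP, Or.inl (this ▸ hx₀)⟩
  obtain ⟨w, hwx₀, q, hq⟩ := w₀.exists_pred hw₀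
  have hwfar : ∀ P, Adm H L P → w ∉ P := by
    intro P hP h
    have := hmin P hP w h q
    omega
  have fin : (∃ P, Adm H L P ∧ (w ∈ P ∨ ∃ x ∈ P, ∃ u u', Pendant H L P x u u')) →
      ∃ P, Adm H L P ∧ (v ∈ P ∨ ∃ x ∈ P, ∃ u u', Pendant H L P x u u') := by
    rintro ⟨P, h1, h2⟩
    exact ⟨P, h1, Or.inr (h2.resolve_left (hwfar P h1))⟩
  have hwP := hwfar P hP
  have hwL : ∀ r, H.Adj w r → r ∉ P → w ∉ L := by
    intro r hr hrP h
    have := hL.leaf w h x₀ r hwx₀ hr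
    exact hrP (this ▸ hx₀)
  rcases list_exists_first_last (H.Adj w) P ⟨x₀, hx₀, hwx₀⟩ with
    ⟨A, x, B, rfl, hwx, hA, hB⟩ | ⟨A, x, M, y, B, rfl, hwx, hwy, hA, hB⟩
  · rcases e with _ | e
    · have : v = w := Walk.eq_of_length_eq_zero hq
      subst this
      obtain ⟨b, c, h1, h2, h3, h4, h5, h6, h7, h8⟩ := hv3 x hwx
      exact hP.of_single hL hv hwP hwx hA hB h1 h2 h3 h4 h5 h6 h7 h8
    · obtain ⟨r, hrw, q', hq'⟩ := q.exists_pred hq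
      have hrP : r ∉ A ++ x :: B := by
        intro h
        have := hmin _ hP r h q'
        omega
      have hrn : ∀ z ∈ A ++ x :: B, ¬ H.Adj r z := by
        intro z hz h
        have := hmin _ hP z hz (q'.concat h)
        simp at this
        omega
      have hxw : ∀ z ∈ A ++ x :: B, H.Adj w z → z = x := by
        intro z hz h
        rcases List.mem_append.1 hz with hz | hz
        · exact absurd h (hA z hz)
        · rcases List.mem_cons.1 hz with hz | hz
          · exact hz
          · exact absurd h (hB z hz)
      refine ⟨_, hP, Or.inr ⟨x, by simp, w, r, hwL r hrw.symm hrP, ?_, hwP, hrP, hwx.symm,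
        hrw.symm, hxw, hrn⟩⟩
      -- If `r` were a leaf, the path could end in `x, w, r` and would contain `w`, against
      -- minimality.
      intro hrL
      have l1 : Linked H (A ++ [x]) (w :: [r]) := linked_left hwx (B := B)
        (fun z hz => by
          rcases List.mem_cons.1 hz with rfl | hz
          · exact hwP
          · have : z = r := by simpa using hz
            exact this ▸ hrP)
        (fun z hz a ha => by
          rcases List.mem_cons.1 hz with rfl | hz
          · exact hA a ha
          · have : z = r := by simpa using hz
            exact this ▸ hrn a (by simp [ha]))
        (by simpa using hrn x (by simp))
      have := hP.tail (S := [w]) (t := r) (by simp [indPath_cons, hrw.symm, hrw.ne']) l1 hrL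
      exact hwfar _ this (by simp)
  · by_cases hM : M = []
    · subst hM
      change Adm H L (A ++ x :: y :: B) at hP
      change w ∉ A ++ x :: y :: B at hwP
      have hxy : H.Adj x y := hP.ind.adj
      rcases e with _ | e
      · exfalso
        have : v = w := Walk.eq_of_length_eq_zero hq
        subst this
        obtain ⟨b, c, h1, h2, h3, h4, h5, h6, h7, h8⟩ := hv3 x hwx
        refine hL.deg v x b c y hwx h1 h2 hwy ?_
        simp
        refine ⟨⟨h3.symm, h4.symm, hxy.ne⟩, ⟨h5, ?_⟩, ?_⟩
        · rintro rfl; exact h7 hxy.symm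
        · rintro rfl; exact h8 hxy.symm
      · obtain ⟨r, hrw, q', hq'⟩ := q.exists_pred hq
        have hrP : r ∉ A ++ x :: y :: B := by
          intro h
          have := hmin _ hP r h q'
          omega
        have hrn : ∀ z ∈ A ++ x :: y :: B, ¬ H.Adj r z := by
          intro z hz h
          have := hmin _ hP z hz (q'.concat h)
          simp at this
          omega
        -- The walk from `v` to `w` is shorter than the distance from `v` to the path, so it misses
        -- the clique `{x, y}`; hence `w` is not separated from `L` either.
        have hqs : ∀ z ∈ q.support, z ∉ ({x, y} : Set V) := by
          intro z hz h
          have h1 : z ∈ A ++ x :: y :: B := by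
            rcases h with rfl | rfl <;> simp
          have h2 := hmin _ hP z h1 (q.takeUntil z hz)
          have h3 := q.length_takeUntil_le_length hz
          omega
        have hvw : (H.isolate {x, y}).Reachable v w := reachable_isolate_of_walk q hqs
        obtain ⟨t, h1, h2, h3⟩ := hK {x, y} (by
          intro a ha b hb hab
          rcases ha with rfl | rfl <;> rcases hb with rfl | rfl
          · exact absurd rfl hab
          · exact hxy
          · exact hxy.symm
          · exact absurd rfl hab) (hqs v (by simp))
        refine fin (hP.of_triangle hL hwP hwx hwy ?_ hrw.symm hrP hrn
          ⟨t, h1, h2, hvw.symm.trans h3⟩)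
        intro z hz h
        simp only [List.mem_append, List.mem_cons] at hz
        rcases hz with hz | hz | hz | hz
        · exact absurd h (hA z hz)
        · exact Or.inl hz
        · exact Or.inr hz
        · exact absurd h (hB z hz)
    · exfalso
      have l1 : Linked H (A ++ [x]) [w] := linked_left hwx (B := M ++ y :: B)
        (by simpa using hwP) (by simpa using hA) (by simp)
      have l2 : Linked H ([] ++ [w]) (y :: B) := linked_right hwy (A := A ++ x :: M)
        (by simpa using hwP) (by simpa using hB) (by simp)
      exact hwfar _ (hP.splice hM (indPath_singleton w) (by simp) l1 l2) (by simp)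

end

/-! ### Induced cycles as indexed sequences -/

section
variable {V : Type*} {G : SimpleGraph V}

instance : DecidableRel S222.Adj := fun i j =>
  decidable_of_iff (s(i, j) ∈ ({s(0, 1), s(0, 2), s(0, 3), s(1, 4), s(2, 5), s(3, 6)} :
    Finset (Sym2 (Fin 7))) ∧ i ≠ j) (by simp [S222])

/-- Injectivity comes for free, since distinct vertices of `S222` have distinct neighborhoods. -/
theorem isCenter_of_adj_iff (f : Fin 7 → V) (h : ∀ i j, i < j → (G.Adj (f i) (f j) ↔ S222.Adj i j)) :
    IsCenterOfInducedS222 G (f 0) := by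
  have h' : ∀ i j, G.Adj (f i) (f j) ↔ S222.Adj i j := by
    intro i j
    rcases lt_trichotomy i j with hij | rfl | hij
    · exact h i j hij
    · simp
    · rw [G.adj_comm, S222.adj_comm]
      exact h j i hij
  have hinj : Function.Injective f := by
    intro i j hij
    have key : ∀ i j : Fin 7, (∀ k, S222.Adj i k ↔ S222.Adj j k) → i = j := by decide
    refine key i j fun k => ?_
    rw [← h', ← h', hij]
  exact ⟨⟨⟨f, hinj⟩, fun {i j} => h' i j⟩, rfl⟩

/-- The vertices `c 0, …, c (q - 1)` form an induced cycle of `G`, in this order. -/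
structure IsIndCycle (G : SimpleGraph V) (q : ℕ) (c : ℕ → V) : Prop where
  three : 3 ≤ q
  ne : ∀ i j, i < j → j < q → c i ≠ c j
  adj : ∀ i j, i < j → j < q → (G.Adj (c i) (c j) ↔ j = i + 1 ∨ i = 0 ∧ j + 1 = q)

theorem IsIndCycle.inj {q : ℕ} {c : ℕ → V} (h : IsIndCycle G q c) {i j : ℕ} (hi : i < q)
    (hj : j < q) (hij : c i = c j) : i = j := by
  rcases lt_trichotomy i j with h1 | h1 | h1
  · exact absurd hij (h.ne i j h1 hj)
  · exact h1
  · exact absurd hij.symm (h.ne j i h1 hi)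

theorem IsIndCycle.exists_embedding {q : ℕ} {c : ℕ → V} (h : IsIndCycle G q c) :
    ∃ f : cycleGraph q ↪g G, ∀ i, f i = c i := by
  obtain ⟨n, rfl⟩ : ∃ n, q = n + 2 := ⟨q - 2, by have := h.three; omega⟩
  have hadj : ∀ i j : Fin (n + 2), i < j → (G.Adj (c i) (c j) ↔ (cycleGraph (n + 2)).Adj i j) := by
    intro i j hij
    have hi := i.isLt
    have hj := j.isLt
    have hij' : (i : ℕ) < j := hij
    rw [h.adj i j hij hj, cycleGraph_adj', Fin.sub_val_of_le hij.le]
    rw [Fin.val_sub, Nat.mod_eq_of_lt (by omega)]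
    omega
  refine ⟨⟨⟨fun i => c i, fun i j hij => Fin.ext (h.inj i.isLt j.isLt hij)⟩, fun {i j} => ?_⟩,
    fun i => rfl⟩
  change G.Adj (c i) (c j) ↔ _
  rcases lt_trichotomy i j with hij | rfl | hij
  · exact hadj i j hij
  · simp
  · rw [G.adj_comm, (cycleGraph (n + 2)).adj_comm]
    exact hadj j i hij

theorem exists_isIndCycle {q : ℕ} (hq : 3 ≤ q) (f : cycleGraph q ↪g G) :
    ∃ c, IsIndCycle G q c := by
  obtain ⟨n, rfl⟩ : ∃ n, q = n + 2 := ⟨q - 2, by omega⟩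
  have hlt : ∀ i, i < n + 2 → i % (n + 2) = i := fun i hi => Nat.mod_eq_of_lt hi
  refine ⟨fun i => f ⟨i % (n + 2), Nat.mod_lt _ (by omega)⟩, hq, ?_, ?_⟩
  · intro i j hij hj h
    have := congrArg Fin.val (f.injective h)
    simp only [hlt i (by omega), hlt j hj] at this
    omega
  · intro i j hij hj
    rw [f.map_adj_iff, cycleGraph_adj']
    simp only [hlt i (by omega), hlt j hj]
    rw [Fin.sub_val_of_le (a := ⟨j, hj⟩) (b := ⟨i, by omega⟩) (by simpa using hij.le), Fin.val_sub]
    simp only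
    rw [Nat.mod_eq_of_lt (by omega)]
    omega

theorem IsIndCycle.rotate {q : ℕ} {c : ℕ → V} (h : IsIndCycle G q c) {k : ℕ} (hk : k < q) :
    IsIndCycle G q (fun j => if j + k < q then c (j + k) else c (j + k - q)) := by
  have h3 := h.three
  refine ⟨h.three, ?_, ?_⟩
  · intro i j hij hj
    split_ifs with h1 h2 h2
    · exact h.ne _ _ (by omega) (by omega)
    · exact (h.ne _ _ (by omega) (by omega)).symm
    · omega
    · exact h.ne _ _ (by omega) (by omega)
  · intro i j hij hj
    split_ifs with h1 h2 h2
    · rw [h.adj _ _ (by omega) (by omega)]; omega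
    · rw [G.adj_comm, h.adj _ _ (by omega) (by omega)]; omega
    · omega
    · rw [h.adj _ _ (by omega) (by omega)]; omega

theorem rotate_surj {q k i : ℕ} (c : ℕ → V) (hk : k < q) (hi : i < q) :
    ∃ j < q, (if j + k < q then c (j + k) else c (j + k - q)) = c i := by
  by_cases h : k ≤ i
  · exact ⟨i - k, by omega, by rw [if_pos (by omega)]; congr 1; omega⟩
  · exact ⟨i + q - k, by omega, by rw [if_neg (by omega)]; congr 1; omega⟩

theorem rotate_mem {q k j : ℕ} (c : ℕ → V) (hk : k < q) (hj : j < q) :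
    ∃ i < q, c i = (if j + k < q then c (j + k) else c (j + k - q)) := by
  by_cases h : j + k < q
  · exact ⟨j + k, h, by rw [if_pos h]⟩
  · exact ⟨j + k - q, by omega, by rw [if_neg h]⟩

/-- A vertex of an induced cycle carrying a pendant path of length two is a center. -/
theorem IsIndCycle.isCenter {q : ℕ} {c : ℕ → V} (h : IsIndCycle G q c) (hq : 6 ≤ q) {i : ℕ}
    (hi : i < q) {u u' : V} (hu : G.Adj (c i) u) (huu : G.Adj u u')
    (h1 : ∀ j < q, G.Adj u (c j) → c j = c i) (h2 : ∀ j < q, ¬ G.Adj u' (c j)) :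
    IsCenterOfInducedS222 G (c i) := by
  -- After rotation the center has index 2 and its legs along the cycle are `1, 0` and `3, 4`;
  -- length at least 6 keeps 0 and 4 nonadjacent.
  obtain ⟨c', hc', hci, hmem⟩ : ∃ c' : ℕ → V, IsIndCycle G q c' ∧ c' 2 = c i ∧
      ∀ j < q, ∃ i < q, c i = c' j := by
    by_cases h2 : 2 ≤ i
    · refine ⟨_, h.rotate (k := i - 2) (by omega), ?_, fun j hj => rotate_mem c (by omega) hj⟩
      rw [if_pos (by omega)]; congr 1; omega
    · refine ⟨_, h.rotate (k := i + q - 2) (by omega), ?_, fun j hj => rotate_mem c (by omega) hj⟩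
      rw [if_neg (by omega)]; congr 1; omega
  have h1' : ∀ j < q, j ≠ 2 → ¬ G.Adj u (c' j) ∧ ¬ G.Adj (c' j) u := by
    intro j hj hj2
    have : ¬ G.Adj u (c' j) := by
      intro hadj
      obtain ⟨k, hk, hkj⟩ := hmem j hj
      rw [← hkj] at hadj
      have := h1 k hk hadj
      rw [hkj, ← hci] at this
      exact hj2 (hc'.inj hj (by omega) this)
    exact ⟨this, fun h => this h.symm⟩
  have h2' : ∀ j < q, ¬ G.Adj (c' j) u' := by
    intro j hj h
    obtain ⟨k, hk, hkj⟩ := hmem j hj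
    rw [← hkj] at h
    exact h2 k hk h.symm
  rw [← hci] at hu ⊢
  have hA : ∀ i j, i < 5 → j < 5 → (G.Adj (c' i) (c' j) ↔ j = i + 1 ∨ i = j + 1) := by
    intro i j hi hj
    rcases lt_trichotomy i j with hij | rfl | hij
    · rw [hc'.adj i j hij (by omega)]; omega
    · simp
    · rw [G.adj_comm, hc'.adj j i hij (by omega)]; omega
  refine isCenter_of_adj_iff ![c' 2, c' 1, c' 3, u, c' 0, c' 4, u'] ?_
  intro i j hij
  have e := fun j (hj : j < q) (h : j ≠ 2) => (h1' j hj h).1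
  have e' := fun j (hj : j < q) (h : j ≠ 2) => (h1' j hj h).2
  have a0 := e 0 (by omega) (by omega)
  have a1 := e' 1 (by omega) (by omega)
  have a3 := e' 3 (by omega) (by omega)
  have a4 := e 4 (by omega) (by omega)
  have b0 := h2' 0 (by omega)
  have b1 := h2' 1 (by omega)
  have b2 := h2' 2 (by omega)
  have b3 := h2' 3 (by omega)
  have b4 := h2' 4 (by omega)
  fin_cases i <;> fin_cases j <;> revert hij <;>
    simp [S222, hu, huu, a0, a1, a3, a4, b0, b1, b2, b3, b4, hA]

theorem IndPath.exists_fun {l : List V} (h : IndPath G l) (hl : l ≠ []) :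
    ∃ s : ℕ → V, (∀ i < l.length, s i ∈ l) ∧ (∀ z ∈ l, ∃ i < l.length, s i = z) ∧
      (∀ i j, i < j → j < l.length → s i ≠ s j ∧ (G.Adj (s i) (s j) ↔ j = i + 1)) ∧
      l.head? = some (s 0) ∧ l.getLast? = some (s (l.length - 1)) := by
  induction l with
  | nil => exact absurd rfl hl
  | cons x l ih =>
    rcases eq_or_ne l [] with rfl | hne
    · refine ⟨fun _ => x, by simp, by simp, ?_, by simp, by simp⟩
      intro i j hij hj
      simp at hj
      omega
    · obtain ⟨s, h1, h2, h3, h4, h5⟩ := ih h.1 hne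
      have hpos : 0 < l.length := List.length_pos_iff.2 hne
      refine ⟨fun i => if i = 0 then x else s (i - 1), ?_, ?_, ?_, by simp, ?_⟩
      · intro i hi
        dsimp only
        split_ifs with h0
        · simp
        · simp at hi
          exact List.mem_cons_of_mem _ (h1 _ (by omega))
      · intro z hz
        rcases List.mem_cons.1 hz with rfl | hz
        · exact ⟨0, by simp, by simp⟩
        · obtain ⟨i, hi, rfl⟩ := h2 z hz
          exact ⟨i + 1, by simpa using hi, by simp⟩
      · intro i j hij hj
        simp at hj
        dsimp only
        rw [if_neg (by omega : j ≠ 0)]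
        split_ifs with h0
        · subst h0
          have hm := h1 (j - 1) (by omega)
          have hx := h.2.2 _ hm
          refine ⟨fun e => h.2.1 (e ▸ hm), ?_⟩
          rw [hx, h4]
          constructor
          · intro e
            by_contra hne
            exact (h3 0 (j - 1) (by omega) (by omega)).1 (by simpa using e)
          · rintro rfl
            rfl
        · have := h3 (i - 1) (j - 1) (by omega) (by omega)
          refine ⟨this.1, this.2.trans (by omega)⟩
      · rw [List.getLast?_cons_of_ne_nil hne, h5]
        dsimp only
        rw [if_neg (by simp [hne])]
        simp

/-- Closing a path by an induced path attached to both of its ends. -/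
theorem exists_isIndCycle_of_paths {a : ℕ → V} {l : ℕ}
    (ha : ∀ i j, i < j → j ≤ l → a i ≠ a j ∧ (G.Adj (a i) (a j) ↔ j = i + 1))
    {Q : List V} (hQ : IndPath G Q) (hQ0 : Q ≠ []) (hlen : 2 ≤ l + Q.length)
    (hne : ∀ z ∈ Q, ∀ j ≤ l, a j ≠ z)
    (hadj : ∀ z ∈ Q, ∀ j ≤ l, (G.Adj (a j) z ↔ j = l ∧ Q.head? = some z ∨
      j = 0 ∧ Q.getLast? = some z)) :
    ∃ c, IsIndCycle G (l + 1 + Q.length) c ∧ (∀ j ≤ l, c j = a j) ∧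
      (∀ z ∈ Q, ∃ i < l + 1 + Q.length, c i = z) ∧
      ∀ i < l + 1 + Q.length, c i ∈ Q ∨ ∃ j ≤ l, c i = a j := by
  obtain ⟨s, h1, h2, h3, h4, h5⟩ := hQ.exists_fun hQ0
  have hpos : 0 < Q.length := List.length_pos_iff.2 hQ0
  have sinj : ∀ i j, i < Q.length → j < Q.length → (s i = s j ↔ i = j) := by
    intro i j hi hj
    refine ⟨fun e => ?_, fun e => e ▸ rfl⟩
    rcases lt_trichotomy i j with h | h | h
    · exact absurd e (h3 i j h hj).1
    · exact h
    · exact absurd e.symm (h3 j i h hi).1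
  refine ⟨fun i => if i ≤ l then a i else s (i - l - 1), ⟨by omega, ?_, ?_⟩, ?_, ?_, ?_⟩
  · intro i j hij hj
    split_ifs with h6 h7 h7
    · exact (ha i j hij h7).1
    · exact hne _ (h1 _ (by omega)) _ h6
    · omega
    · exact (h3 _ _ (by omega) (by omega)).1
  · intro i j hij hj
    split_ifs with h6 h7 h7
    · rw [(ha i j hij h7).2]; omega
    · rw [hadj _ (h1 _ (by omega)) _ h6, h4, h5, Option.some.injEq, Option.some.injEq,
        sinj _ _ (by omega) (by omega), sinj _ _ (by omega) (by omega)]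
      omega
    · omega
    · rw [(h3 _ _ (by omega) (by omega)).2]; omega
  · intro j hj
    simp [hj]
  · intro z hz
    obtain ⟨i, hi, rfl⟩ := h2 z hz
    refine ⟨l + 1 + i, by omega, ?_⟩
    dsimp only
    rw [if_neg (by omega)]
    congr 1
    omega
  · intro i hi
    dsimp only
    split_ifs with h6
    · exact Or.inr ⟨i, h6, rfl⟩
    · exact Or.inl (h1 _ (by omega))

/-- Some arc between consecutive vertices of `X` has at least the average length. -/
theorem IsIndCycle.exists_long_arc {p : ℕ} {c : ℕ → V} (h : IsIndCycle G p c) (X : Finset V)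
    {m : ℕ} (hm : X.card ≤ m) {x₁ x₂ : V} (h1 : x₁ ∈ X) (h2 : x₂ ∈ X) (hne : x₁ ≠ x₂)
    (hX : ∀ x ∈ X, ∃ i < p, c i = x) :
    ∃ c' l, IsIndCycle G p c' ∧ (∀ j < p, ∃ i < p, c i = c' j) ∧ (∀ i < p, ∃ j < p, c' j = c i) ∧
      0 < l ∧ l < p ∧ p ≤ m * l ∧ c' 0 ∈ X ∧ c' l ∈ X ∧ ∀ j, 0 < j → j < l → c' j ∉ X := by
  classical
  wlog h0 : c 0 = x₁ generalizing c
  · obtain ⟨k, hk, hk1⟩ := hX x₁ h1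
    obtain ⟨c', l, g1, g2, g3, g4⟩ := this (h.rotate hk)
      (fun x hx => by
        obtain ⟨i, hi, rfl⟩ := hX x hx
        exact rotate_surj c hk hi) (by simpa [hk] using hk1)
    refine ⟨c', l, g1, ?_, ?_, g4⟩
    · intro j hj
      obtain ⟨i, hi, e⟩ := g2 j hj
      obtain ⟨i', hi', e'⟩ := rotate_mem c hk hi
      exact ⟨i', hi', e'.trans e⟩
    · intro i hi
      obtain ⟨i', hi', e'⟩ := rotate_surj c hk hi
      obtain ⟨j, hj, e⟩ := g3 i' hi'
      exact ⟨j, hj, e.trans e'⟩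
  have h3 := h.three
  -- The gap at `i` is the number of steps to the next vertex of `X`. Index `p` counts as a hit
  -- because it stands for index 0, and `c 0` lies in `X`.
  have hgap : ∀ i, i < p → ∃ k, 0 < k ∧ (i + k = p ∨ i + k < p ∧ c (i + k) ∈ X) :=
    fun i hi => ⟨p - i, by omega, Or.inl (by omega)⟩
  set I := (Finset.range p).filter (fun i => c i ∈ X) with hI
  have hIX : I.card ≤ X.card := by
    refine Finset.card_le_card_of_injOn c (fun i hi => ?_) ?_
    · exact (Finset.mem_filter.1 hi).2
    · intro i hi j hj e
      have hi := (Finset.mem_filter.1 hi).1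
      have hj := (Finset.mem_filter.1 hj).1
      exact h.inj (by simpa using hi) (by simpa using hj) e
  let gap : ℕ → ℕ := fun i => if hi : i < p then Nat.find (hgap i hi) else 0
  have gap_spec : ∀ i, i < p → 0 < gap i ∧ (i + gap i = p ∨ i + gap i < p ∧ c (i + gap i) ∈ X) := by
    intro i hi
    have := Nat.find_spec (hgap i hi)
    simpa only [gap, dif_pos hi] using this
  have gap_min : ∀ i, i < p → ∀ k, 0 < k → (i + k = p ∨ i + k < p ∧ c (i + k) ∈ X) →
      gap i ≤ k := by
    intro i hi k hk h
    simpa only [gap, dif_pos hi] using Nat.find_min' (hgap i hi) ⟨hk, h⟩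
  have h0I : 0 ∈ I := by
    rw [hI, Finset.mem_filter, h0]
    exact ⟨by simp; omega, h1⟩
  obtain ⟨i, hiI, himax⟩ := Finset.exists_max_image I gap ⟨0, h0I⟩
  have hip : i < p := by simpa using (Finset.mem_filter.1 hiI).1
  have hiX : c i ∈ X := (Finset.mem_filter.1 hiI).2
  -- The arcs starting at indices of `X` cover the cycle, so the longest has at least the average
  -- length.
  have hcover : Finset.range p ⊆ I.biUnion (fun i => Finset.Ico i (i + gap i)) := by
    intro j hj
    have hj : j < p := by simpa using hj
    obtain ⟨k, hk, hkmax⟩ := Finset.exists_max_image (I.filter (· ≤ j)) id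
      ⟨0, Finset.mem_filter.2 ⟨h0I, by omega⟩⟩
    obtain ⟨hkI, hkj⟩ := Finset.mem_filter.1 hk
    refine Finset.mem_biUnion.2 ⟨k, hkI, Finset.mem_Ico.2 ⟨hkj, ?_⟩⟩
    by_contra hlt
    obtain ⟨g1, g2⟩ := gap_spec k (by omega)
    have hmem : k + gap k ∈ I.filter (· ≤ j) := by
      rw [Finset.mem_filter, hI, Finset.mem_filter, Finset.mem_range]
      exact ⟨⟨by omega, (g2.resolve_left (by omega)).2⟩, by omega⟩
    have := hkmax _ hmem
    simp at this
    omega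
  have hcard : p ≤ m * gap i := by
    calc p = (Finset.range p).card := by simp
      _ ≤ _ := Finset.card_le_card hcover
      _ ≤ ∑ k ∈ I, (Finset.Ico k (k + gap k)).card := Finset.card_biUnion_le
      _ ≤ ∑ k ∈ I, gap i := Finset.sum_le_sum fun k hk => by simpa using himax k hk
      _ = I.card * gap i := by simp
      _ ≤ m * gap i := Nat.mul_le_mul_right _ (hIX.trans hm)
  obtain ⟨g1, g2⟩ := gap_spec i hip
  -- The second element of `X` prevents the arc from going all the way round.
  have hlt : gap i < p := by
    obtain ⟨j, hj, hjx⟩ := hX x₂ h2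
    have hj0 : j ≠ 0 := by
      rintro rfl
      exact hne (h0.symm.trans hjx)
    have hg0 := gap_min 0 (by omega) j (by omega) (Or.inr ⟨by omega, by simpa [hjx] using h2⟩)
    rcases Nat.eq_zero_or_pos i with rfl | hi
    · omega
    · omega
  refine ⟨_, gap i, h.rotate hip, fun j hj => rotate_mem c hip hj,
    fun j hj => rotate_surj c hip hj, g1, hlt, hcard, ?_, ?_, ?_⟩
  · simpa [hip] using hiX
  · rcases g2 with g2 | g2
    · rw [if_neg (by omega)]
      have : gap i + i - p = 0 := by omega
      rw [this, h0]
      exact h1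
    · rw [if_pos (by omega), add_comm]
      exact g2.2
  · intro j hj hjl
    have hjp : i + j < p := by omega
    rw [if_pos (by omega), add_comm]
    intro hmem
    have := gap_min i hip j hj (Or.inr ⟨hjp, hmem⟩)
    omega

/-! ### Long arcs and the cycles closed from them -/

/-- An induced cycle of length at least `p / 12` through a center. -/
def LongCenter (G : SimpleGraph V) (p : ℕ) : Prop :=
  ∃ q c, IsIndCycle G q c ∧ p ≤ 12 * q ∧ ∃ i < q, IsCenterOfInducedS222 G (c i)

/-- No vertex has four neighbors. -/
def Subcubic (G : SimpleGraph V) : Prop :=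
  ∀ x a b c d, G.Adj x a → G.Adj x b → G.Adj x c → G.Adj x d → ¬ [a, b, c, d].Nodup

/-- The vertex set of the cycle `c 0, …, c (p - 1)`. -/
def cycleSet (p : ℕ) (c : ℕ → V) : Set V := {z | ∃ i < p, c i = z}

theorem IsIndCycle.exists_two_nbrs {p : ℕ} {c : ℕ → V} (h : IsIndCycle G p c) {z : V}
    (hz : z ∈ cycleSet p c) : ∃ z₁ ∈ cycleSet p c, ∃ z₂ ∈ cycleSet p c, z₁ ≠ z₂ ∧
      G.Adj z z₁ ∧ G.Adj z z₂ := by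
  obtain ⟨i, hi, rfl⟩ := hz
  have h3 := h.three
  have hr := h.rotate hi
  have e0 : (if 0 + i < p then c (0 + i) else c (0 + i - p)) = c i := by simp [hi]
  have h1 := (hr.adj 0 1 (by omega) (by omega)).2 (by omega)
  have h2 := (hr.adj 0 (p - 1) (by omega) (by omega)).2 (by omega)
  have h4 := hr.ne 1 (p - 1) (by omega) (by omega)
  rw [e0] at h1 h2
  exact ⟨_, rotate_mem c hi (by omega), _, rotate_mem c hi (by omega), h4, h1, h2⟩

theorem IsIndCycle.outer_nbr_unique {p : ℕ} {c : ℕ → V} (h : IsIndCycle G p c)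
    (hd : Subcubic G) {z u u' : V} (hz : z ∈ cycleSet p c) (hu : u ∉ cycleSet p c)
    (hu' : u' ∉ cycleSet p c) (hzu : G.Adj u z) (hzu' : G.Adj u' z) : u = u' := by
  obtain ⟨z₁, h1, z₂, h2, h3, h4, h5⟩ := h.exists_two_nbrs hz
  by_contra hne
  refine hd z z₁ z₂ u u' h4 h5 hzu.symm hzu'.symm ?_
  simp
  refine ⟨⟨h3, ?_, ?_⟩, ⟨?_, ?_⟩, hne⟩ <;> rintro rfl <;> contradiction

/-- A long arc between consecutive vertices of a set of at most six vertices of the cycle. -/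
theorem IsIndCycle.exists_arc {p : ℕ} {c : ℕ → V} (h : IsIndCycle G p c) (hp : 49 ≤ p)
    (X : Finset V) (hm : X.card ≤ 6) {x₁ x₂ : V} (h1 : x₁ ∈ X) (h2 : x₂ ∈ X) (hne : x₁ ≠ x₂)
    (hX : ∀ x ∈ X, x ∈ cycleSet p c) :
    ∃ a l, IsIndCycle G p a ∧ cycleSet p a = cycleSet p c ∧ 6 ≤ l ∧ l < p ∧ p ≤ 12 * l ∧
      a 0 ∈ X ∧ a l ∈ X ∧ ∀ j ≤ l, a j ∈ X → j = 0 ∨ j = l := by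
  obtain ⟨a, l, g1, g2, g3, g4, g5, g6, g7, g8, g9⟩ := h.exists_long_arc X hm h1 h2 hne hX
  refine ⟨a, l, g1, ?_, by omega, g5, by omega, g7, g8, ?_⟩
  · ext z
    constructor
    · rintro ⟨i, hi, rfl⟩
      exact g2 i hi
    · rintro ⟨i, hi, rfl⟩
      exact g3 i hi
  · intro j hj hjX
    by_contra hne
    exact g9 j (by omega) (by omega) hjX

theorem IsIndCycle.close_arc {p : ℕ} {a : ℕ → V} (h : IsIndCycle G p a) {l : ℕ} (hl6 : 6 ≤ l)
    (hl : l + 2 ≤ p) {Q : List V} (hQ : IndPath G Q) (hQ0 : Q ≠ [])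
    (hne : ∀ z ∈ Q, z ∉ cycleSet p a)
    (hadj : ∀ z ∈ Q, ∀ j ≤ l, (G.Adj (a j) z ↔ j = l ∧ Q.head? = some z ∨
      j = 0 ∧ Q.getLast? = some z)) :
    ∃ q c, IsIndCycle G q c ∧ l ≤ q ∧ (∀ z ∈ Q, ∃ i < q, c i = z) ∧
      ∀ i < q, c i ∈ Q ∨ ∃ j ≤ l, c i = a j := by
  obtain ⟨c, h1, -, h2, h3⟩ := exists_isIndCycle_of_paths (a := a) (l := l) (G := G)
    (fun i j hij hj => ⟨h.ne i j hij (by omega), (h.adj i j hij (by omega)).trans (by omega)⟩)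
    hQ hQ0 (by omega) (fun z hz j hj e => hne z hz ⟨j, by omega, e⟩) hadj
  exact ⟨_, c, h1, by omega, h2, h3⟩

/-- A long arc between consecutive neighbors of `t` closes through `t`. Its ends are nonadjacent, so
the arc is not the whole cycle minus an edge and has no chord. -/
theorem IsIndCycle.exists_through [Fintype V] [DecidableRel G.Adj] {p : ℕ} {c : ℕ → V}
    (h : IsIndCycle G p c) (hp : 49 ≤ p) (hdeg : ∀ v, G.degree v ≤ 3) {t z₁ z₂ : V}
    (ht : t ∉ cycleSet p c) (hz₁ : z₁ ∈ cycleSet p c) (hz₂ : z₂ ∈ cycleSet p c) (hne : z₁ ≠ z₂)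
    (h1 : G.Adj t z₁) (h2 : G.Adj t z₂)
    (hna : ∀ z ∈ cycleSet p c, ∀ z' ∈ cycleSet p c, G.Adj t z → G.Adj t z' → ¬ G.Adj z z') :
    ∃ q c', IsIndCycle G q c' ∧ 6 ≤ q ∧ p ≤ 12 * q ∧ (∃ i < q, c' i = t) ∧
      ∀ i < q, c' i = t ∨ c' i ∈ cycleSet p c := by
  classical
  set X : Finset V := Finset.univ.filter (fun z => G.Adj t z ∧ z ∈ cycleSet p c) with hX
  have hmem : ∀ z, z ∈ X ↔ G.Adj t z ∧ z ∈ cycleSet p c := by simp [hX]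
  have hcard : X.card ≤ 6 := by
    have : X ⊆ G.neighborFinset t := fun z hz => by simpa using ((hmem z).1 hz).1
    have := Finset.card_le_card this
    have h3 := hdeg t
    rw [← G.card_neighborFinset_eq_degree] at h3
    omega
  obtain ⟨a, l, g1, g2, g3, g4, g5, g6, g7, g8⟩ := h.exists_arc hp X hcard
    ((hmem z₁).2 ⟨h1, hz₁⟩) ((hmem z₂).2 ⟨h2, hz₂⟩) hne (fun x hx => ((hmem x).1 hx).2)
  have hl : l + 2 ≤ p := by
    by_contra hlt
    have h3 := (g1.adj 0 l (by omega) g4).2 (by omega)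
    rw [hmem] at g6 g7
    exact hna _ g6.2 _ g7.2 g6.1 g7.1 h3
  obtain ⟨q, c', k1, k2, k3, k4⟩ := g1.close_arc g3 hl (indPath_singleton t) (by simp)
    (by simpa [g2] using ht) (by
      intro z hz j hj
      have : z = t := by simpa using hz
      subst this
      have hjS : a j ∈ cycleSet p c := by
        rw [← g2]; exact ⟨j, by omega, rfl⟩
      rw [G.adj_comm]
      simp only [List.head?_cons, List.getLast?_singleton, and_true]
      constructor
      · intro hadj
        exact (g8 j hj ((hmem _).2 ⟨hadj, hjS⟩)).symm
      · rintro (rfl | rfl)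
        · exact ((hmem _).1 g7).1
        · exact ((hmem _).1 g6).1)
  refine ⟨q, c', k1, by omega, by omega, k3 t (by simp), fun i hi => ?_⟩
  rcases k4 i hi with h | ⟨j, hj, h⟩
  · exact Or.inl (by simpa using h)
  · refine Or.inr ?_
    rw [h, ← g2]
    exact ⟨j, by omega, rfl⟩

/-- If each neighbor of a center lies on the cycle or is attached to it, there is a long induced
cycle through a center. -/
theorem IsIndCycle.longCenter_of_star [Fintype V] [DecidableRel G.Adj] {p : ℕ} {c : ℕ → V}
    (h : IsIndCycle G p c) (hp : 49 ≤ p) (hdeg : ∀ v, G.degree v ≤ 3) (hd : Subcubic G) {v : V}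
    (hv : v ∉ cycleSet p c) (hc : IsCenterOfInducedS222 G v)
    (hna : ∀ n n', G.Adj v n → G.Adj v n' → ¬ G.Adj n n')
    (h3 : ∀ n n', ∃ m, G.Adj v m ∧ m ≠ n ∧ m ≠ n')
    (h2 : ∀ n, ∃ m, G.Adj v m ∧ m ≠ n ∧ m ∉ cycleSet p c)
    (hatt : ∀ n, G.Adj v n → n ∈ cycleSet p c ∨ ∃ y ∈ cycleSet p c, G.Adj n y) :
    LongCenter G p := by
  classical
  set S := cycleSet p c with hS
  let att : V → V → Prop := fun n y => y ∈ S ∧ (y = n ∨ n ∉ S ∧ G.Adj n y)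
  have att_ex : ∀ n, G.Adj v n → ∃ y, att n y := by
    intro n hn
    by_cases hnS : n ∈ S
    · exact ⟨n, hnS, Or.inl rfl⟩
    · obtain ⟨y, hy, h⟩ := (hatt n hn).resolve_left hnS
      exact ⟨y, hy, Or.inr ⟨hnS, h⟩⟩
  -- Attachments of different neighbors of `v` are disjoint: these neighbors are pairwise
  -- nonadjacent, and a cycle vertex has at most one neighbor off the cycle.
  have att_unique : ∀ n n' y, G.Adj v n → G.Adj v n' → att n y → att n' y → n = n' := by
    rintro n n' y hn hn' ⟨hy, h1⟩ ⟨-, h2⟩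
    rcases h1 with rfl | ⟨h1, h1'⟩ <;> rcases h2 with rfl | ⟨h2, h2'⟩
    · rfl
    · exact absurd h2' (hna _ _ hn' hn)
    · exact absurd h1' (hna _ _ hn hn')
    · exact h.outer_nbr_unique hd hy h1 h2 h1' h2'
  set X : Finset V := (G.neighborFinset v).biUnion
    (fun n => Finset.univ.filter (fun y => att n y)) with hX
  have hmem : ∀ y, y ∈ X ↔ ∃ n, G.Adj v n ∧ att n y := by simp [hX]
  have hcard2 : ∀ n ∈ G.neighborFinset v, (Finset.univ.filter (fun y => att n y)).card ≤ 2 := by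
    intro n hn
    have hvn : G.Adj v n := by simpa using hn
    by_cases hnS : n ∈ S
    · have : Finset.univ.filter (fun y => att n y) ⊆ {n} := by
        intro y hy
        have : att n y := by simpa using hy
        simpa [hnS] using this.2
      have := Finset.card_le_card this
      simp at this ⊢
      omega
    · have : Finset.univ.filter (fun y => att n y) ⊆ (G.neighborFinset n).erase v := by
        intro y hy
        have h4 : att n y := by simpa using hy
        rw [Finset.mem_erase]
        refine ⟨?_, ?_⟩
        · rintro rfl; exact hv h4.1
        · rcases h4.2 with rfl | h5
          · exact absurd h4.1 hnS
          · simpa using h5.2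
      have := Finset.card_le_card this
      rw [Finset.card_erase_of_mem (by simpa using hvn.symm)] at this
      have h3 := hdeg n
      rw [← G.card_neighborFinset_eq_degree] at h3
      omega
  -- Three neighbors of `v`, each with at most two attachments.
  have hcard : X.card ≤ 6 := by
    have h4 : X.card ≤ ∑ n ∈ G.neighborFinset v, 2 :=
      Finset.card_biUnion_le.trans (Finset.sum_le_sum hcard2)
    have h3 := hdeg v
    rw [← G.card_neighborFinset_eq_degree] at h3
    simp at h4 h3
    omega
  obtain ⟨n₁, hn₁, -⟩ := h3 v v
  obtain ⟨n₂, hn₂, hne, -⟩ := h3 n₁ n₁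
  obtain ⟨y₁, hy₁⟩ := att_ex n₁ hn₁
  obtain ⟨y₂, hy₂⟩ := att_ex n₂ hn₂
  obtain ⟨a, l, g1, g2, g3, g4, g5, g6, g7, g8⟩ := h.exists_arc hp X hcard
    ((hmem y₁).2 ⟨n₁, hn₁, hy₁⟩) ((hmem y₂).2 ⟨n₂, hn₂, hy₂⟩)
    (by rintro rfl; exact hne (att_unique _ _ _ hn₂ hn₁ hy₂ hy₁))
    (fun x hx => by
      obtain ⟨n, -, h⟩ := (hmem x).1 hx
      exact h.1)
  rw [← hS] at g2
  obtain ⟨n, hn, hn0⟩ := (hmem _).1 g6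
  obtain ⟨n', hn', hnl⟩ := (hmem _).1 g7
  have haS : ∀ j ≤ l, a j ∈ S := fun j hj => by rw [← g2]; exact ⟨j, by omega, rfl⟩
  have hends : ∀ j ≤ l, ∀ m, G.Adj v m → att m (a j) → j = 0 ∧ m = n ∨ j = l ∧ m = n' := by
    intro j hj m hm hmj
    rcases g8 j hj ((hmem _).2 ⟨m, hm, hmj⟩) with rfl | rfl
    · exact Or.inl ⟨rfl, att_unique _ _ _ hm hn hmj hn0⟩
    · exact Or.inr ⟨rfl, att_unique _ _ _ hm hn' hmj hnl⟩
  -- A third neighbor of `v` has an attachment different from both ends, and it must lie outside the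
  -- arc.
  have hl : l + 2 ≤ p := by
    by_contra hlt
    obtain ⟨m, hm, hmn, hmn'⟩ := h3 n n'
    obtain ⟨y, hy⟩ := att_ex m hm
    have hyS := hy.1
    rw [← g2] at hyS
    obtain ⟨j, hj, rfl⟩ := hyS
    rcases hends j (by omega) m hm hy with h | h
    · exact hmn h.2
    · exact hmn' h.2
  have hva : ∀ j ≤ l, G.Adj (a j) v → j = 0 ∧ a j = n ∨ j = l ∧ a j = n' :=
    fun j hj hadj => hends j hj (a j) hadj.symm ⟨haS j hj, Or.inl rfl⟩
  have hma : ∀ j ≤ l, ∀ m, G.Adj v m → m ∉ S → G.Adj (a j) m → j = 0 ∧ m = n ∨ j = l ∧ m = n' :=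
    fun j hj m hm hmS hadj => hends j hj m hm ⟨haS j hj, Or.inr ⟨hmS, hadj.symm⟩⟩
  have hn0' : n ∉ S → G.Adj (a 0) n := by
    intro hnS
    rcases hn0.2 with h | h
    · exact absurd (h ▸ hn0.1) hnS
    · exact h.2.symm
  have hnl' : n' ∉ S → G.Adj (a l) n' := by
    intro hnS
    rcases hnl.2 with h | h
    · exact absurd (h ▸ hnl.1) hnS
    · exact h.2.symm
  have hn0S : n ∈ S → a 0 = n := fun hnS => hn0.2.resolve_right fun h => h.1 hnS
  have hnlS : n' ∈ S → a l = n' := fun hnS => hnl.2.resolve_right fun h => h.1 hnS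
  -- If both ends attach to the same `n`, the arc closes through `n`, which the pendant path `n, v,
  -- m` makes a center. Otherwise it closes through `n', v, n`, leaving out those of `n`, `n'` that
  -- lie on `S`, and contains `v`.
  by_cases hnn : n = n'
  · subst hnn
    have hnS : n ∉ S := by
      intro hnS
      have := g1.inj (by omega) g4 ((hn0S hnS).trans (hnlS hnS).symm)
      omega
    obtain ⟨q, c', k1, k2, k3, k4⟩ := g1.close_arc g3 hl (indPath_singleton n) (by simp)
      (by simpa [g2] using hnS) (by
        intro z hz j hj
        have : z = n := by simpa using hz
        subst this
        simp only [List.head?_cons, List.getLast?_singleton, and_true]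
        constructor
        · intro hadj
          rcases hma j hj z hn hnS hadj with h | h
          · exact Or.inr h.1
          · exact Or.inl h.1
        · rintro (rfl | rfl)
          · exact hnl' hnS
          · exact hn0' hnS)
    obtain ⟨i, hi, hin⟩ := k3 n (by simp)
    obtain ⟨m, hm, hmn, hmS⟩ := h2 n
    refine ⟨q, c', k1, by omega, i, hi, k1.isCenter (by omega) hi (u := v) (u' := m)
      (by rw [hin]; exact hn.symm) hm ?_ ?_⟩
    · intro j hj hadj
      rcases k4 j hj with h | ⟨k, hk, h⟩
      · rw [hin]; simpa using h
      · exfalso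
        rw [h] at hadj
        have : a k = n := (hva k hk hadj.symm).elim And.right And.right
        exact hnS (this ▸ haS k hk)
    · intro j hj hadj
      rcases k4 j hj with h | ⟨k, hk, h⟩
      · have h : c' j = n := by simpa using h
        rw [h] at hadj
        exact hna _ _ hm hn hadj
      · rw [h] at hadj
        exact hmn ((hma k hk m hm hmS hadj.symm).elim And.right And.right)
  · have hvn := hn.ne
    have hvn' := hn'.ne
    have nnn := hna _ _ hn hn'
    have nnn' := hna _ _ hn' hn
    have fin : ∀ Q : List V, IndPath G Q → v ∈ Q → (∀ z ∈ Q, z ∉ S) →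
        (∀ z ∈ Q, ∀ j ≤ l, (G.Adj (a j) z ↔ j = l ∧ Q.head? = some z ∨
          j = 0 ∧ Q.getLast? = some z)) → LongCenter G p := by
      intro Q q1 q2 q3 q4
      obtain ⟨q, c', k1, k2, k3, k4⟩ := g1.close_arc g3 hl q1 (List.ne_nil_of_mem q2)
        (by rw [g2]; exact q3) q4
      obtain ⟨i, hi, hin⟩ := k3 v q2
      exact ⟨q, c', k1, by omega, i, hi, by rw [hin]; exact hc⟩
    have adj_n : n ∉ S → ∀ j ≤ l, (G.Adj (a j) n ↔ j = 0) := by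
      intro hnS j hj
      constructor
      · intro hadj
        rcases hma j hj n hn hnS hadj with h | h
        · exact h.1
        · exact absurd h.2 hnn
      · rintro rfl; exact hn0' hnS
    have adj_n' : n' ∉ S → ∀ j ≤ l, (G.Adj (a j) n' ↔ j = l) := by
      intro hnS j hj
      constructor
      · intro hadj
        rcases hma j hj n' hn' hnS hadj with h | h
        · exact absurd h.2.symm hnn
        · exact h.1
      · rintro rfl; exact hnl' hnS
    have adj_v : ∀ j ≤ l, (G.Adj (a j) v ↔ j = 0 ∧ n ∈ S ∨ j = l ∧ n' ∈ S) := by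
      intro j hj
      constructor
      · intro hadj
        rcases hva j hj hadj with h | h
        · exact Or.inl ⟨h.1, h.2 ▸ haS j hj⟩
        · exact Or.inr ⟨h.1, h.2 ▸ haS j hj⟩
      · rintro (⟨rfl, h⟩ | ⟨rfl, h⟩)
        · rw [hn0S h]; exact hn.symm
        · rw [hnlS h]; exact hn'.symm
    by_cases hnS : n ∈ S <;> by_cases hnS' : n' ∈ S
    · refine fin [v] (by simp) (by simp) (by simpa using hv) ?_
      intro z hz j hj
      have : z = v := by simpa using hz
      subst this
      rw [adj_v j hj]
      simp [hnS, hnS', or_comm]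
    · refine fin [n', v] (by simp [indPath_cons, hn'.symm, hvn'.symm]) (by simp)
        (by simp [hnS', hv]) ?_
      intro z hz j hj
      have hz : z = n' ∨ z = v := by simpa using hz
      rcases hz with rfl | rfl
      · rw [adj_n' hnS' j hj]
        simp [hvn']
      · rw [adj_v j hj]
        simp [hnS, hnS', hvn'.symm]
    · refine fin [v, n] (by simp [indPath_cons, hn, hvn]) (by simp)
        (by simp [hnS, hv]) ?_
      intro z hz j hj
      have hz : z = v ∨ z = n := by simpa using hz
      rcases hz with rfl | rfl
      · rw [adj_v j hj]
        simp [hnS, hnS', hvn.symm]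
      · rw [adj_n hnS j hj]
        simp [hvn]
    · refine fin [n', v, n] (by simp [indPath_cons, hn, hvn, hn'.symm, hvn'.symm, nnn', Ne.symm hnn])
        (by simp) (by simp [hnS, hnS', hv]) ?_
      intro z hz j hj
      have hz : z = n' ∨ z = v ∨ z = n := by simpa using hz
      rcases hz with rfl | rfl | rfl
      · rw [adj_n' hnS' j hj]
        simp [hnn]
      · rw [adj_v j hj]
        simp [hnS, hnS', hvn.symm, hvn'.symm]
      · rw [adj_n hnS j hj]
        simp [Ne.symm hnn]

/-! ### Claws; closing a path across the cycle -/

/-- The neighbors of `v` are three pairwise nonadjacent vertices. -/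
def IsClaw (G : SimpleGraph V) (v : V) : Prop :=
  ∃ a b c, G.Adj v a ∧ G.Adj v b ∧ G.Adj v c ∧ a ≠ b ∧ a ≠ c ∧ b ≠ c ∧ ¬ G.Adj a b ∧
    ¬ G.Adj a c ∧ ¬ G.Adj b c ∧ ∀ n, G.Adj v n → n = a ∨ n = b ∨ n = c

theorem IsCenterOfInducedS222.isClaw (hd : Subcubic G) {v : V}
    (hv : IsCenterOfInducedS222 G v) : IsClaw G v := by
  obtain ⟨f, rfl⟩ := hv
  have h1 : G.Adj (f 0) (f 1) := f.map_adj_iff.2 (by decide)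
  have h2 : G.Adj (f 0) (f 2) := f.map_adj_iff.2 (by decide)
  have h3 : G.Adj (f 0) (f 3) := f.map_adj_iff.2 (by decide)
  have h4 : f 1 ≠ f 2 := f.injective.ne (by decide)
  have h5 : f 1 ≠ f 3 := f.injective.ne (by decide)
  have h6 : f 2 ≠ f 3 := f.injective.ne (by decide)
  refine ⟨f 1, f 2, f 3, h1, h2, h3, h4, h5, h6, ?_, ?_, ?_, ?_⟩
  · exact fun h => absurd (f.map_adj_iff.1 h) (by decide)
  · exact fun h => absurd (f.map_adj_iff.1 h) (by decide)
  · exact fun h => absurd (f.map_adj_iff.1 h) (by decide)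
  · intro n hn
    by_contra hne
    push Not at hne
    refine hd _ _ _ _ _ h1 h2 h3 hn ?_
    simp
    exact ⟨hne.1.symm, hne.2.1.symm, hne.2.2.symm⟩

theorem IsClaw.not_adj {v n n' : V} (h : IsClaw G v) (hn : G.Adj v n) (hn' : G.Adj v n') :
    ¬ G.Adj n n' := by
  obtain ⟨a, b, c, -, -, -, -, -, -, h1, h2, h3, h4⟩ := h
  intro hadj
  rcases h4 n hn with rfl | rfl | rfl <;> rcases h4 n' hn' with rfl | rfl | rfl <;>
    first
    | exact hadj.ne rfl
    | contradiction
    | (have := hadj.symm; contradiction)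

theorem IsClaw.exists_third {v : V} (h : IsClaw G v) (n n' : V) :
    ∃ m, G.Adj v m ∧ m ≠ n ∧ m ≠ n' := by
  obtain ⟨a, b, c, h1, h2, h3, h4, h5, h6, -⟩ := h
  by_cases ha : a ≠ n ∧ a ≠ n'
  · exact ⟨a, h1, ha⟩
  by_cases hb : b ≠ n ∧ b ≠ n'
  · exact ⟨b, h2, hb⟩
  refine ⟨c, h3, ?_, ?_⟩
  · rintro rfl
    have : a = n' := by tauto
    subst this
    tauto
  · rintro rfl
    have : a = n := by tauto
    subst this
    tauto

theorem reachable_isolate {K : Set V} (h : (G.induce Kᶜ).Preconnected) {x y : V} (hx : x ∉ K)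
    (hy : y ∉ K) : (G.isolate K).Reachable x y := by
  let φ : G.induce Kᶜ →g G.isolate K := ⟨Subtype.val, fun {a b} hab => ⟨hab, a.2, b.2⟩⟩
  exact (h ⟨x, hx⟩ ⟨y, hy⟩).map φ

/-- A shortest path off `v` from the neighbor `a` to `{b, d}` meets `{b, d}` only at its end, so
adding `v` creates no chord. As `a` is adjacent to neither, the path has at least three vertices. -/
theorem exists_isIndCycle_of_isClaw {v : V} (hv : IsClaw G v)
    (h : (G.induce ({v} : Set V)ᶜ).Preconnected) :
    ∃ q c, IsIndCycle G q c ∧ 4 ≤ q ∧ ∃ i < q, c i = v := by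
  obtain ⟨a, b, d, h1, h2, h3, h4, h5, -, h6, h7, -, h8⟩ := hv
  obtain ⟨A, s, t, hh, hi, ht, hQ, -⟩ := exists_indPath_to_set (G.isolate {v}) {b, d} a
    (by simp [h4, h5]) ⟨b, by simp, reachable_isolate h h1.ne' h2.ne'⟩
  have hvm : ∀ z ∈ A ++ [s, t], z ∉ ({v} : Set V) := by
    intro z hz
    obtain ⟨z', -, h⟩ := hi.exists_adj (by simp) hz
    exact h.2.1
  have hi := hi.of_isolate hvm
  have hhead : (A ++ [s, t]).head? = some a := by
    rcases A with _ | ⟨a', A⟩ <;> simpa using hh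
  have hlast : (A ++ [s, t]).getLast? = some t := by simp
  have hA : A ≠ [] := by
    rintro rfl
    have hsa : s = a := by simpa using hh
    have hst : G.Adj s t := IndPath.adj (A := []) (B := []) hi
    subst hsa
    rcases ht with rfl | rfl
    · exact h6 hst
    · exact h7 hst
  have hvt : G.Adj v t := by
    rcases ht with rfl | rfl <;> assumption
  have hpos := List.length_pos_iff.2 hA
  obtain ⟨c, k1, k2, -⟩ := exists_isIndCycle_of_paths (a := fun _ => v) (l := 0)
    (fun i j hij hj => by omega) hi (by simp) (by simp)
    (fun z hz j _ e => hvm z hz e.symm) (by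
      intro z hz j hj
      have hj : j = 0 := by omega
      subst hj
      rw [hhead, hlast]
      simp only [true_and, Option.some.injEq]
      constructor
      · intro hadj
        rcases h8 z hadj with rfl | hz'
        · exact Or.inl rfl
        · right
          by_contra hne
          exact hQ z (by simp at hz ⊢; tauto) (by simpa using hz')
      · rintro (rfl | rfl) <;> assumption)
  exact ⟨_, c, k1, by simp; omega, 0, by simp, k2 0 le_rfl⟩

/-- The ends of `P` attach to the cycle at the ends of two edges without common vertices. A longest
arc between consecutive attachments leads from one end of `P` to the other and closes with `P`. -/
theorem IsIndCycle.exists_through_path [Fintype V] [DecidableRel G.Adj] {p : ℕ} {c : ℕ → V}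
    (h : IsIndCycle G p c) (hp : 49 ≤ p) (hdeg : ∀ v, G.degree v ≤ 3) (hd : Subcubic G)
    {P : List V} (hP : IndPath G P) {t₁ t₂ : V} (hh : P.head? = some t₁)
    (hl : P.getLast? = some t₂) (hne : t₁ ≠ t₂) (hPS : ∀ z ∈ P, z ∉ cycleSet p c)
    (hatt : ∀ z ∈ P, ∀ y ∈ cycleSet p c, G.Adj z y → z = t₁ ∨ z = t₂)
    (htri : ∀ t, t = t₁ ∨ t = t₂ → ∃ z ∈ cycleSet p c, ∃ z' ∈ cycleSet p c, G.Adj z z' ∧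
      G.Adj t z ∧ G.Adj t z' ∧ ∀ y ∈ cycleSet p c, G.Adj t y → y = z ∨ y = z') :
    ∃ q c', IsIndCycle G q c' ∧ 6 ≤ q ∧ p ≤ 12 * q ∧ (∀ z ∈ P, ∃ i < q, c' i = z) ∧
      ∀ i < q, c' i ∈ P ∨ c' i ∈ cycleSet p c := by
  classical
  have hm₁ := List.mem_of_head? hh
  have hm₂ := List.mem_of_getLast? hl
  set S := cycleSet p c with hS
  have uniq : ∀ y ∈ S, G.Adj t₁ y → ¬ G.Adj t₂ y := fun y hy h1 h2 =>
    hne (h.outer_nbr_unique hd hy (hPS _ hm₁) (hPS _ hm₂) h1 h2)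
  set X : Finset V := Finset.univ.filter (fun y => y ∈ S ∧ (G.Adj t₁ y ∨ G.Adj t₂ y)) with hX
  have hmem : ∀ y, y ∈ X ↔ y ∈ S ∧ (G.Adj t₁ y ∨ G.Adj t₂ y) := by simp [hX]
  have hcard : X.card ≤ 6 := by
    have h1 : X ⊆ G.neighborFinset t₁ ∪ G.neighborFinset t₂ := by
      intro y hy
      have := ((hmem y).1 hy).2
      simpa using this
    have h2 := (Finset.card_le_card h1).trans (Finset.card_union_le _ _)
    have h3 := hdeg t₁
    have h4 := hdeg t₂
    rw [← G.card_neighborFinset_eq_degree] at h3 h4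
    omega
  obtain ⟨z₁, hz₁, z₁', hz₁', e1, e2, e3, e4⟩ := htri t₁ (Or.inl rfl)
  obtain ⟨z₂, hz₂, z₂', hz₂', f1, f2, f3, f4⟩ := htri t₂ (Or.inr rfl)
  obtain ⟨a, l, g1, g2, g3, g4, g5, g6, g7, g8⟩ := h.exists_arc hp X hcard
    ((hmem z₁).2 ⟨hz₁, Or.inl e2⟩) ((hmem z₁').2 ⟨hz₁', Or.inl e3⟩) e1.ne
    (fun x hx => ((hmem x).1 hx).1)
  rw [← hS] at g2
  have haS : ∀ j ≤ l, a j ∈ S := fun j hj => by rw [← g2]; exact ⟨j, by omega, rfl⟩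
  have hfull : ¬ l + 2 ≤ p → ∀ y ∈ X, y = a 0 ∨ y = a l := by
    intro hlt y hy
    have hyS := ((hmem y).1 hy).1
    rw [← g2] at hyS
    obtain ⟨j, hj, rfl⟩ := hyS
    rcases g8 j (by omega) hy with rfl | rfl
    · exact Or.inl rfl
    · exact Or.inr rfl
  -- If both ends of the arc belong to one `t`, they are adjacent, so the arc is the whole cycle
  -- minus that edge. It would then contain the attachments of the other end of `P` in its interior.
  have same : ∀ t z z', G.Adj z z' → (∀ y ∈ S, G.Adj t y → y = z ∨ y = z') →
      G.Adj t (a 0) → G.Adj t (a l) → ¬ l + 2 ≤ p := by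
    intro t z z' hzz hall h0 hl hlp
    have hadj : G.Adj (a 0) (a l) := by
      have hne0 : a 0 ≠ a l := g1.ne 0 l (by omega) g4
      rcases hall _ (haS 0 (by omega)) h0 with h | h <;>
        rcases hall _ (haS l le_rfl) hl with h' | h'
      · exact absurd (h.trans h'.symm) hne0
      · rw [h, h']; exact hzz
      · rw [h, h']; exact hzz.symm
      · exact absurd (h.trans h'.symm) hne0
    have := (g1.adj 0 l (by omega) g4).1 hadj
    omega
  have hz₂X := (hmem z₂).2 ⟨hz₂, Or.inr f2⟩
  have hz₁X := (hmem z₁).2 ⟨hz₁, Or.inl e2⟩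
  have hz₁X' := (hmem z₁').2 ⟨hz₁', Or.inl e3⟩
  have main : ∀ Q t t', IndPath G Q → Q.head? = some t → Q.getLast? = some t' →
      (∀ z, z ∈ Q ↔ z ∈ P) → G.Adj t (a l) → G.Adj t' (a 0) → (t = t₁ ∧ t' = t₂ ∨
      t = t₂ ∧ t' = t₁) → ∃ q c', IsIndCycle G q c' ∧ 6 ≤ q ∧ p ≤ 12 * q ∧
      (∀ z ∈ P, ∃ i < q, c' i = z) ∧ ∀ i < q, c' i ∈ P ∨ c' i ∈ S := by
    intro Q t t' hQ hQh hQl hQP htl ht0 htt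
    have uniq' : ∀ y ∈ S, G.Adj t y → ¬ G.Adj t' y := by
      rcases htt with ⟨rfl, rfl⟩ | ⟨rfl, rfl⟩
      · exact uniq
      · exact fun y hy h1 h2 => uniq y hy h2 h1
    -- If the arc contained all of `S`, its two ends would be the only attachments, one for each end
    -- of `P`; but `t₁` alone has two.
    have hlp : l + 2 ≤ p := by
      by_contra hlt
      have hboth : ∀ y ∈ X, ∀ y' ∈ X, y ≠ y' → G.Adj t₁ y → ¬ G.Adj t₁ y' := by
        intro y hy y' hy' hyy h1 h2
        rcases hfull hlt y hy with r | r <;> rcases hfull hlt y' hy' with r' | r'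
        · exact hyy (r.trans r'.symm)
        · rw [r] at h1
          rw [r'] at h2
          rcases htt with ⟨rfl, rfl⟩ | ⟨rfl, rfl⟩
          · exact uniq _ (haS 0 (by omega)) h1 ht0
          · exact uniq _ (haS l le_rfl) h2 htl
        · rw [r] at h1
          rw [r'] at h2
          rcases htt with ⟨rfl, rfl⟩ | ⟨rfl, rfl⟩
          · exact uniq _ (haS 0 (by omega)) h2 ht0
          · exact uniq _ (haS l le_rfl) h1 htl
        · exact hyy (r.trans r'.symm)
      exact hboth _ hz₁X _ hz₁X' e1.ne e2 e3
    have hQ0 : Q ≠ [] := by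
      rintro rfl
      simp at hQh
    obtain ⟨q, c', k1, k2, k3, k4⟩ := g1.close_arc g3 hlp hQ hQ0
      (fun z hz => by rw [g2]; exact hPS z ((hQP z).1 hz)) (by
        intro z hz j hj
        rw [hQh, hQl]
        simp only [Option.some.injEq]
        constructor
        · intro hadj
          have hzt : z = t ∨ z = t' := by
            have := hatt z ((hQP z).1 hz) _ (haS j hj) hadj.symm
            rcases htt with ⟨rfl, rfl⟩ | ⟨rfl, rfl⟩
            · exact this
            · exact this.symm
          have hjX : a j ∈ X := by
            rw [hmem]
            refine ⟨haS j hj, ?_⟩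
            rcases hatt z ((hQP z).1 hz) _ (haS j hj) hadj.symm with rfl | rfl
            · exact Or.inl hadj.symm
            · exact Or.inr hadj.symm
          rcases g8 j hj hjX with rfl | rfl
          · rcases hzt with rfl | rfl
            · exact absurd ht0 (uniq' _ (haS 0 hj) hadj.symm)
            · exact Or.inr ⟨rfl, rfl⟩
          · rcases hzt with rfl | rfl
            · exact Or.inl ⟨rfl, rfl⟩
            · exact absurd hadj.symm (uniq' _ (haS _ hj) htl)
        · rintro (⟨rfl, rfl⟩ | ⟨rfl, rfl⟩)
          · exact htl.symm
          · exact ht0.symm)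
    refine ⟨q, c', k1, by omega, by omega, fun z hz => k3 z ((hQP z).2 hz), fun i hi => ?_⟩
    rcases k4 i hi with h | ⟨j, hj, h⟩
    · exact Or.inl ((hQP _).1 h)
    · exact Or.inr (h ▸ haS j hj)
  rcases ((hmem _).1 g6).2 with h0 | h0 <;> rcases ((hmem _).1 g7).2 with hl' | hl'
  · exfalso
    have hlt := same t₁ z₁ z₁' e1 e4 h0 hl'
    rcases hfull hlt z₂ hz₂X with r | r
    · exact uniq _ hz₂ (r ▸ h0) f2
    · exact uniq _ hz₂ (r ▸ hl') f2
  · exact main P.reverse t₂ t₁ hP.reverse (by simpa using hl) (by simpa using hh)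
      (fun z => List.mem_reverse) hl' h0 (Or.inr ⟨rfl, rfl⟩)
  · exact main P t₁ t₂ hP hh hl (fun z => Iff.rfl) hl' h0 (Or.inl ⟨rfl, rfl⟩)
  · exfalso
    have hlt := same t₂ z₂ z₂' f1 f4 h0 hl'
    rcases hfull hlt z₁ hz₁X with r | r
    · exact uniq _ hz₁ e2 (r ▸ h0)
    · exact uniq _ hz₁ e2 (r ▸ hl')

/-! ### The component of the center away from the cycle -/

theorem Reachable.exists_pred {H : SimpleGraph V} {x y : V} (h : H.Reachable x y) (hne : x ≠ y) :
    ∃ w, H.Reachable x w ∧ H.Adj w y := by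
  obtain ⟨w⟩ := h
  rcases hn : w.length with _ | n
  · exact absurd (Walk.eq_of_length_eq_zero hn) hne
  · obtain ⟨z, hz, q, -⟩ := w.exists_pred hn
    exact ⟨z, ⟨q⟩, hz⟩

theorem Reachable.notMem_of_isolate {K : Set V} {x y : V} (h : (G.isolate K).Reachable x y)
    (hx : x ∉ K) : y ∉ K := by
  by_cases hxy : x = y
  · exact hxy ▸ hx
  · obtain ⟨w, -, h⟩ := h.exists_pred hxy
    exact h.2.2

/-- A set containing `x` and closed under adjacency contains all that is reachable from `x`. -/
theorem Reachable.mem_of_closed {H : SimpleGraph V} {R : Set V}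
    (hR : ∀ u ∈ R, ∀ u', H.Adj u u' → u' ∈ R) {x y : V} (h : H.Reachable x y) (hx : x ∈ R) :
    y ∈ R := by
  obtain ⟨w⟩ := h
  induction w with
  | nil => exact hx
  | cons hadj _ ih => exact ih (hR _ hx _ hadj)

/-- The edges of `G` with an end in `I`. -/
def edgesAt (G : SimpleGraph V) (I : Set V) : SimpleGraph V where
  Adj x y := G.Adj x y ∧ (x ∈ I ∨ y ∈ I)
  symm := ⟨fun _ _ h => ⟨h.1.symm, h.2.symm⟩⟩
  loopless := ⟨fun _ h => G.loopless.irrefl _ h.1⟩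

theorem IndPath.congr {G' : SimpleGraph V} {l : List V} (h : IndPath G l)
    (hl : ∀ x ∈ l, ∀ y ∈ l, (G'.Adj x y ↔ G.Adj x y)) : IndPath G' l := by
  induction l with
  | nil => simp
  | cons x l ih =>
    refine ⟨ih h.1 fun a ha b hb => hl a (by simp [ha]) b (by simp [hb]), h.2.1, fun y hy => ?_⟩
    rw [hl x (by simp) y (by simp [hy])]
    exact h.2.2 y hy

theorem Adm.end_of_mem {H : SimpleGraph V} {L : Set V} (hL : Leafy H L) {P : List V}
    (h : Adm H L P) {z : V} (hz : z ∈ P) (hzL : z ∈ L) :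
    P.head? = some z ∨ P.getLast? = some z := by
  obtain ⟨A, B, rfl⟩ := List.append_of_mem hz
  rcases B with _ | ⟨b, B⟩
  · right; simp
  · rcases List.eq_nil_or_concat A with rfl | ⟨A, a, rfl⟩
    · left; simp
    · exfalso
      have hi := h.ind
      have e : A.concat a ++ z :: b :: B = A ++ a :: z :: b :: B := by simp
      rw [e] at hi
      have h1 := hi.adj
      have h2 := IndPath.adj (A := []) hi.right.1
      have h3 := hi.right.2.1
      have := hL.leaf z hzL a b h1.symm h2
      exact h3 (by simp [this])

theorem IsIndCycle.longCenter_of_pendant {p : ℕ} {c : ℕ → V} (h : IsIndCycle G p c)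
    (hp : 49 ≤ p) {x u u' : V} (hx : x ∈ cycleSet p c) (hu : G.Adj x u)
    (huu : G.Adj u u') (h1 : ∀ z ∈ cycleSet p c, G.Adj u z → z = x)
    (h2 : ∀ z ∈ cycleSet p c, ¬ G.Adj u' z) : LongCenter G p := by
  obtain ⟨i, hi, rfl⟩ := hx
  exact ⟨p, c, h, by omega, i, hi, h.isCenter (by omega) hi hu huu
    (fun j hj hadj => h1 _ ⟨j, hj, rfl⟩ hadj) (fun j hj => h2 _ ⟨j, hj, rfl⟩)⟩

/-- Assuming no long cycle through a center, the attachments to `S` of the component of `v` are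
forced to be triangles, which is the setting of `exists_adm_center`. -/
theorem IsIndCycle.longCenter [Fintype V] [DecidableRel G.Adj] {p : ℕ} {c : ℕ → V}
    (h : IsIndCycle G p c) (hp : 49 ≤ p) (hdeg : ∀ v, G.degree v ≤ 3) (hd : Subcubic G)
    (hsep : ∀ K : Set V, G.IsClique K → (G.induce Kᶜ).Preconnected)
    {v : V} (hv : IsCenterOfInducedS222 G v) : LongCenter G p := by
  classical
  by_contra hno
  have hclaw := hv.isClaw hd
  set S := cycleSet p c with hS
  have hvS : v ∉ S := by
    rintro ⟨i, hi, rfl⟩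
    exact hno ⟨p, c, h, by omega, i, hi, hv⟩
  set T : Set V := {u | u ∉ S ∧ ∃ y ∈ S, G.Adj u y} with hT
  have pend : ∀ x ∈ S, ∀ u u', G.Adj x u → (∀ z ∈ S, G.Adj u z → z = x) → G.Adj u u' →
      u' ∉ S → u' ∈ T := by
    intro x hx u u' hxu hux huu huS'
    by_contra huT
    exact hno (h.longCenter_of_pendant hp hx hxu huu hux
      (fun z hz hadj => huT ⟨huS', z, hz, hadj⟩))
  have star : (∀ n, ∃ m, G.Adj v m ∧ m ≠ n ∧ m ∉ S) → (∀ n, G.Adj v n → n ∈ S ∨ n ∈ T) → False :=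
    fun h1 h2 => hno (h.longCenter_of_star hp hdeg hd hvS hv (fun n n' => hclaw.not_adj)
      hclaw.exists_third h1 (fun n hn => (h2 n hn).imp id And.right))
  -- With two neighbors on `S`, `v` closes a long arc itself. With a single one `x`, any neighbor
  -- `n` of `v` outside `S ∪ T` would give the pendant path `x, v, n`, so `star` applies.
  have hvT : v ∉ T := by
    rintro ⟨-, x, hx, hvx⟩
    by_cases hex : ∃ z ∈ S, z ≠ x ∧ G.Adj v z
    · obtain ⟨z, hz, hzx, hvz⟩ := hex
      obtain ⟨q, c', k1, k2, k3, ⟨i, hi, k4⟩, -⟩ := h.exists_through hp hdeg hvS hz hx hzx hvz hvx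
        (fun z _ z' _ h1 h2 => hclaw.not_adj h1 h2)
      exact hno ⟨q, c', k1, k3, i, hi, by rw [k4]; exact hv⟩
    · have honly : ∀ z ∈ S, G.Adj v z → z = x := by
        intro z hz hvz
        by_contra hne
        exact hex ⟨z, hz, hne, hvz⟩
      refine star ?_ ?_
      · intro n
        obtain ⟨m, h1, h2, h3⟩ := hclaw.exists_third n x
        exact ⟨m, h1, h2, fun hm => h3 (honly m hm h1)⟩
      · intro n hn
        by_cases hnS : n ∈ S
        · exact Or.inl hnS
        · exact Or.inr (pend x hx v n hvx.symm honly hn hnS)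
  set I : Set V := {u | (G.isolate (S ∪ T)).Reachable v u} with hI
  have hvI : v ∈ I := Reachable.refl v
  have hvST : v ∉ S ∪ T := by simp [hvS, hvT]
  have hIS : ∀ u ∈ I, u ∉ S ∧ u ∉ T := by
    intro u hu
    have := Reachable.notMem_of_isolate hu hvST
    simpa using this
  have hstep : ∀ u ∈ I, ∀ u', G.Adj u u' → u' ∉ T → u' ∈ I := by
    intro u hu u' hadj hT'
    obtain ⟨h1, h2⟩ := hIS u hu
    have h3 : u' ∉ S := fun h3 => h2 ⟨h1, u', h3, hadj⟩
    have : (G.isolate (S ∪ T)).Adj u u' := ⟨hadj, by simp [h1, h2], by simp [h3, hT']⟩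
    exact Reachable.trans hu this.reachable
  have key : ∀ t ∈ T, ∀ w ∈ I, G.Adj t w → ∃ z ∈ S, ∃ z' ∈ S, G.Adj z z' ∧ G.Adj t z ∧
      G.Adj t z' ∧ ∀ n, G.Adj t n → n = z ∨ n = z' ∨ n = w := by
    rintro t ⟨htS, z, hz, htz⟩ w hw htw
    obtain ⟨hwS, hwT⟩ := hIS w hw
    obtain ⟨z', hz', hne, htz'⟩ : ∃ z' ∈ S, z' ≠ z ∧ G.Adj t z' := by
      by_contra hex
      push Not at hex
      refine hwT (pend z hz t w htz.symm (fun y hy hty => ?_) htw hwS)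
      by_contra hyz
      exact hex y hy hyz hty
    have hall : ∀ n, G.Adj t n → n = z ∨ n = z' ∨ n = w := by
      intro n hn
      by_contra hnn
      push Not at hnn
      refine hd t z z' w n htz htz' htw hn ?_
      simp
      refine ⟨⟨hne.symm, ?_, hnn.1.symm⟩, ⟨?_, hnn.2.1.symm⟩, hnn.2.2.symm⟩
      · rintro rfl; exact hwS hz
      · rintro rfl; exact hwS hz'
    refine ⟨z, hz, z', hz', ?_, htz, htz', hall⟩
    by_contra hzz
    have hzz' : ¬ G.Adj z' z := fun h => hzz h.symm
    have hall' : ∀ y ∈ S, G.Adj t y → y = z ∨ y = z' := by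
      intro y hy hty
      rcases hall y hty with h | h | h
      · exact Or.inl h
      · exact Or.inr h
      · exact absurd (h ▸ hy) hwS
    obtain ⟨q, c', k1, k2, k3, ⟨i, hi, k4⟩, k5⟩ := h.exists_through hp hdeg htS hz' hz hne htz' htz
      (by
        intro y hy y' hy' h1 h2
        rcases hall' y hy h1 with rfl | rfl <;> rcases hall' y' hy' h2 with rfl | rfl
        · simp
        · exact hzz
        · exact hzz'
        · simp)
    -- The two nonadjacent neighbors of `t` on `S` gave a long cycle through `t`; a neighbor `w'` of
    -- `w` outside `T` would make `t, w, w'` pendant to it.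
    have hwT' : ∀ w', G.Adj w w' → w' ∈ T := by
      intro w' hww
      by_contra hwT'
      have hwI' := hstep w hw w' hww hwT'
      obtain ⟨hwS', -⟩ := hIS w' hwI'
      refine hno ⟨q, c', k1, k3, i, hi, k1.isCenter k2 hi (u := w) (u' := w')
        (by rw [k4]; exact htw) hww ?_ ?_⟩
      · intro j hj hadj
        rcases k5 j hj with h | h
        · rw [h, k4]
        · exact absurd ⟨hwS, _, h, hadj⟩ hwT
      · intro j hj hadj
        rcases k5 j hj with h | h
        · rw [h] at hadj
          rcases hall w' hadj.symm with rfl | rfl | rfl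
          · exact hwS' hz
          · exact hwS' hz'
          · exact hww.ne rfl
        · exact hwT' ⟨hwS', _, h, hadj⟩
    -- Any other vertex of `I` has a neighbor in `I`, hence outside `T`.
    have hvw : v = w := by
      by_contra hvw
      obtain ⟨w', -, hadj⟩ := Reachable.exists_pred hw hvw
      exact hadj.2.1 (Or.inr (hwT' w' hadj.1.symm))
    subst hvw
    refine star ?_ (fun n hn => Or.inr (hwT' n hn))
    intro n
    obtain ⟨m, h1, h2, -⟩ := hclaw.exists_third n n
    exact ⟨m, h1, h2, (hwT' m h1).1⟩
  set L : Set V := {t | t ∈ T ∧ ∃ w ∈ I, G.Adj t w} with hLdef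
  set H := G.edgesAt I with hH
  have hLI : ∀ t ∈ L, t ∉ I := fun t ht htI => (hIS t htI).2 ht.1
  have hIL : ∀ u ∈ I, ∀ u', G.Adj u u' → u' ∈ I ∨ u' ∈ L := by
    intro u hu u' hadj
    by_cases hT' : u' ∈ T
    · exact Or.inr ⟨hT', u, hu, hadj.symm⟩
    · exact Or.inl (hstep u hu u' hadj hT')
  have hLeafy : Leafy H L := by
    refine ⟨?_, ?_, ?_⟩
    · rintro t ht u u' ⟨h1, h1'⟩ ⟨h2, h2'⟩
      have hu := h1'.resolve_left (hLI t ht)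
      have hu' := h2'.resolve_left (hLI t ht)
      obtain ⟨htT, w, hw, htw⟩ := ht
      obtain ⟨z, hz, z', hz', -, -, -, hall⟩ := key t htT w hw htw
      have : ∀ n ∈ I, G.Adj t n → n = w := by
        intro n hn htn
        rcases hall n htn with rfl | rfl | h
        · exact absurd hz (hIS _ hn).1
        · exact absurd hz' (hIS _ hn).1
        · exact h
      rw [this u hu h1, this u' hu' h2]
    · rintro t ht u ⟨h1, h1'⟩ huL
      exact hLI u huL (h1'.resolve_left (hLI t ht))
    · intro x a b c d h1 h2 h3 h4
      exact hd x a b c d h1.1 h2.1 h3.1 h4.1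
  have hvL : v ∉ L := fun h => hLI v h hvI
  have hHG : ∀ x y, H.Adj x y → G.Adj x y := fun x y h => h.1
  obtain ⟨P, hP, hPc⟩ := exists_adm_center hLeafy hvL
    (by
      intro x hx
      obtain ⟨b, hb, hbx, -⟩ := hclaw.exists_third x x
      obtain ⟨d, hd', hdx, hdb⟩ := hclaw.exists_third x b
      exact ⟨b, d, ⟨hb, Or.inl hvI⟩, ⟨hd', Or.inl hvI⟩, hbx, hdx, hdb.symm,
        fun h => hclaw.not_adj hb hd' h.1, fun h => hclaw.not_adj hb hx.1 h.1,
        fun h => hclaw.not_adj hd' hx.1 h.1⟩)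
    (by
      intro K hK hvK
      by_contra hex
      push Not at hex
      have hKG : G.IsClique K := fun a ha b hb hab => hHG a b (hK ha hb hab)
      -- The cycle is too long to lie in a clique, so some `y` on it avoids `K` and is reachable
      -- from `v` off `K`. A walk to `y` can leave `I` only through `L`.
      obtain ⟨y, hyS, hyK⟩ : ∃ y ∈ S, y ∉ K := by
        by_contra hall
        push Not at hall
        have h0 : c 0 ∈ K := hall _ ⟨0, by omega, rfl⟩
        have h2 : c 2 ∈ K := hall _ ⟨2, by omega, rfl⟩
        have := (h.adj 0 2 (by omega) (by omega)).1
          (hKG h0 h2 (h.ne 0 2 (by omega) (by omega)))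
        omega
      have hr := reachable_isolate (hsep K hKG) hvK hyK
      have hmem : y ∈ {u | u ∈ I ∧ (H.isolate K).Reachable v u} := by
        refine Reachable.mem_of_closed ?_ hr ⟨hvI, Reachable.refl v⟩
        rintro u ⟨hu, hur⟩ u' ⟨hadj, h1, h2⟩
        have hadj' : (H.isolate K).Adj u u' := ⟨⟨hadj, Or.inl hu⟩, h1, h2⟩
        have hr' := hur.trans hadj'.reachable
        rcases hIL u hu u' hadj with h | h
        · exact ⟨h, hr'⟩
        · exact absurd hr' (hex u' h h2)
      exact (hIS y hmem.1).1 hyS)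
  have hPIL : ∀ z ∈ P, z ∈ I ∨ z ∈ L := by
    intro z hz
    obtain ⟨z', -, hadj, h1 | h1⟩ := hP.ind.exists_adj hP.two hz
    · exact Or.inl h1
    · exact hIL z' h1 z hadj.symm
  have hPS : ∀ z ∈ P, z ∉ S := by
    intro z hz
    rcases hPIL z hz with h | h
    · exact (hIS z h).1
    · exact h.1.1
  -- Passing from `H` to `G` adds no chord: the neighbors in `G` of a leaf are two vertices of `S`,
  -- which `P` avoids, and one vertex of `I`.
  have hPG : IndPath G P := by
    refine hP.ind.congr fun x hx y hy => ⟨fun hadj => ⟨hadj, ?_⟩, hHG x y⟩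
    rcases hPIL x hx with h1 | h1
    · exact Or.inl h1
    · right
      obtain ⟨hxT, w, hw, hxw⟩ := h1
      obtain ⟨z, hz, z', hz', -, -, -, hall⟩ := key x hxT w hw hxw
      rcases hall y hadj with rfl | rfl | rfl
      · exact absurd hz (hPS _ hy)
      · exact absurd hz' (hPS _ hy)
      · exact hw
  obtain ⟨t₁, ht₁, hh⟩ := hP.head
  obtain ⟨t₂, ht₂, hl⟩ := hP.last
  have hne : t₁ ≠ t₂ := by
    rintro rfl
    have h2 := hP.two
    have hi := hP.ind
    rcases P with _ | ⟨a, P⟩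
    · simp at hh
    · have ha : a = t₁ := by simpa using hh
      subst ha
      have hP0 : P ≠ [] := by rintro rfl; simp at h2
      rw [List.getLast?_cons_of_ne_nil hP0] at hl
      exact hi.2.1 (List.mem_of_getLast? hl)
  obtain ⟨q, c', k1, k2, k3, k4, k5⟩ := h.exists_through_path hp hdeg hd hPG hh hl hne hPS
    (by
      intro z hz y hy hadj
      have hzL : z ∈ L := (hPIL z hz).resolve_left fun hzI =>
        (hIS z hzI).2 ⟨hPS z hz, y, hy, hadj⟩
      rcases hP.end_of_mem hLeafy hz hzL with h | h
      · rw [hh] at h; exact Or.inl (by simpa using h.symm)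
      · rw [hl] at h; exact Or.inr (by simpa using h.symm))
    (by
      intro t ht
      have htL : t ∈ L := by rcases ht with rfl | rfl <;> assumption
      obtain ⟨htT, w, hw, htw⟩ := htL
      obtain ⟨z, hz, z', hz', h1, h2, h3, hall⟩ := key t htT w hw htw
      refine ⟨z, hz, z', hz', h1, h2, h3, fun y hy hty => ?_⟩
      rcases hall y hty with h | h | h
      · exact Or.inl h
      · exact Or.inr h
      · exact absurd (h ▸ hy) (hIS w hw).1)
  rcases hPc with hvP | ⟨x, hx, u, u', hpe⟩
  · obtain ⟨i, hi, e⟩ := k4 v hvP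
    exact hno ⟨q, c', k1, k3, i, hi, by rw [e]; exact hv⟩
  · obtain ⟨i, hi, e⟩ := k4 x hx
    -- An edge of `H` has an end in `I`, and neither `u` nor `u'` is a leaf, so both lie in `I` and
    -- have no neighbors on `S`.
    obtain ⟨huI, huI'⟩ : u ∈ I ∧ u' ∈ I := by
      rcases hpe.adj₂.2 with h1 | h1
      · exact ⟨h1, (hIL u h1 u' hpe.adj₂.1).resolve_right hpe.notMem₂⟩
      · exact ⟨(hIL u' h1 u hpe.adj₂.1.symm).resolve_right hpe.notMem₁, h1⟩
    refine hno ⟨q, c', k1, k3, i, hi, k1.isCenter k2 hi (u := u) (u' := u')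
      (by rw [e]; exact hpe.adj₁.1) hpe.adj₂.1 ?_ ?_⟩
    · intro j hj hadj
      rcases k5 j hj with h | h
      · rw [e]; exact hpe.only _ h ⟨hadj, Or.inl huI⟩
      · exact absurd ⟨(hIS u huI).1, _, h, hadj⟩ (hIS u huI).2
    · intro j hj hadj
      rcases k5 j hj with h | h
      · exact hpe.none _ h ⟨hadj, Or.inl huI'⟩
      · exact (hIS u' huI').2 ⟨(hIS u' huI').1, _, h, hadj⟩

theorem subcubic_of_degree_le [Fintype V] [DecidableRel G.Adj] (hdeg : ∀ v, G.degree v ≤ 3) :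
    Subcubic G := by
  classical
  intro x a b c d h1 h2 h3 h4 hn
  have hsub : [a, b, c, d].toFinset ⊆ G.neighborFinset x := by
    intro y hy
    simp at hy
    rcases hy with rfl | rfl | rfl | rfl <;> simpa
  have := Finset.card_le_card hsub
  rw [List.toFinset_card_of_nodup hn, G.card_neighborFinset_eq_degree] at this
  have := hdeg x
  simp at *
  omega

end

end SimpleGraph

/-! ### The main theorem -/

theorem mainTheorem4 {V : Type*} [Fintype V] (G : SimpleGraph V) [DecidableRel G.Adj]
    (hconn : G.Connected)
    (hcubic : ∀ v : V, G.degree v ≤ 3)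
    (hsep : ∀ K : Set V, ¬ G.IsSeparatingClique K)
    (p : ℕ) (hp : 3 ≤ p)
    (hC : (SimpleGraph.cycleGraph p).IsIndContained G)
    (hS : SimpleGraph.S222.IsIndContained G) :
    ∃ q : ℕ, 3 ≤ q ∧ (p : ℝ) / 12 ≤ (q : ℝ) ∧
      ∃ (C : SimpleGraph.cycleGraph q ↪g G) (i : Fin q), G.IsCenterOfInducedS222 (C i) := by
  have hsep' : ∀ K : Set V, G.IsClique K → (G.induce Kᶜ).Preconnected := by
    intro K hK
    by_contra h
    exact hsep K ⟨hK, h⟩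
  have hd := SimpleGraph.subcubic_of_degree_le hcubic
  obtain ⟨f⟩ := hS
  have hv : G.IsCenterOfInducedS222 (f 0) := ⟨f, rfl⟩
  obtain ⟨q, c, hc, hpq, i, hi, hci⟩ : SimpleGraph.LongCenter G p := by
    -- For `p ≤ 48 = 12 · 4`, any induced cycle of length at least 4 through the center is long
    -- enough.
    by_cases hp' : 49 ≤ p
    · obtain ⟨g⟩ := hC
      obtain ⟨c, hc⟩ := SimpleGraph.exists_isIndCycle hp g
      exact hc.longCenter hp' hcubic hd hsep' hv
    · obtain ⟨q, c, h1, h2, i, hi, h3⟩ := SimpleGraph.exists_isIndCycle_of_isClaw (hv.isClaw hd)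
        (hsep' {f 0} (by simp))
      exact ⟨q, c, h1, by omega, i, hi, h3 ▸ hv⟩
  obtain ⟨C, hCc⟩ := hc.exists_embedding
  refine ⟨q, hc.three, ?_, C, ⟨i, hi⟩, by rw [hCc]; exact hci⟩
  have : (p : ℝ) ≤ 12 * q := by exact_mod_cast hpq
  linarith
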